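/- Let $\mathcal H$ be a complex Hilbert space with an orthonormal basis $e=(e_k)_{k\in J}$, $J\subseteq\mathbb N$, let $\hbar>0$, and let $H_0$ be a self-adjoint operator that is diagonal in this basis: $H_0e_k=E_0(k)e_k$ with $E_0(k)\in\mathbb R$. Let $\mathcal L_e^{\mathbb C}$ be the algebra of linear operators with domain $\operatorname{Span}_{\mathbb C}(e)$ that preserve $\operatorname{Span}_{\mathbb C}(e)$, let $\mathcal L_e^{\mathbb R}\subset\mathcal L_e^{\mathbb C}$ be the set of symmetric ones, and put $\mathcal L^{\mathbb C}=\mathcal L_e^{\mathbb C}[[\mu]]$, $\mathcal L^{\mathbb R}=\mathcal L_e^{\mathbb R}[[\mu]]$; $H_0$ also denotes the restriction of $H_0$ to $\operatorname{Span}_{\mathbb C}(e)$. Let $B\in\mu\mathcal L^{\mathbb R}$ be finite-band: there is $D\in\mathbb N$ such that $\beta_{k,\ell}(\mu):=(e_k,Be_\ell)=0$ whenever $|k-\ell|>D$. Let $\mathcal N=\{\frac1{i\hbar}(E_0(k)-E_0(\ell)) : k,\ell\in J\}$ and, for $\lambda\in\mathcal N$, let $B_\lambda\in\mathcal L^{\mathbb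 C}$ be the operator with matrix entries $(e_k,B_\lambda e_\ell)=\beta_{k,\ell}(\mu)$ if $E_0(k)-E_0(\ell)=i\hbar\lambda$, and $0$ otherwise. Then $B=\sum_{\lambda\in\mathcal N}B_\lambda$ and $\frac1{i\hbar}[H_0,B_\lambda]=\lambda B_\lambda$. For a word $\underline\lambda=\lambda_1\cdots\lambda_r$ on the alphabet $\mathcal N$ (with $r\ge0$) put $$T^{\underline\lambda}(\varepsilon)=\frac1{(\lambda_1+\varepsilon)(\lambda_1+\lambda_2+2\varepsilon)\cdots(\lambda_1+\cdots+\lambda_r+r\varepsilon)}\in\mathbb C((\varepsilon)).$$ There is a unique pair $(U_-,U_+)$ of families of elements of $\mathbb C((\varepsilon))$ indexed by words (the Birkhoff decomposition of $T$) such that $U_\pm^{\varnothing}=1$, $U_-^{\underline\lambda}\in\varepsilon^{-1}\mathbb C[\varepsilon^{-1}]$ for $\underline\lambda\ne\varnothing$, $U_+^{\underline\lambda}\in\mathbb C[[\varepsilon]]$, and $\sum_{\underline a\,\underline b=\underline\lambda}U_-^{\underline a}T^{\underline b}=U_+^{\underline\lambda}$ for all $\underline\lambda$. It is given inductively by $U_-^{\underline\lambda}=-\pi_-(D^{\underline\lambda})$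 and $U_+^{\underline\lambda}=\pi_+(D^{\underline\lambda})$ for $\underline\lambda\neq\varnothing$, where $D^{\underline\lambda}=\sum_{\underline a\,\underline b=\underline\lambda,\ \underline b\ne\varnothing}U_-^{\underline a}T^{\underline b}$ and $\pi_\pm$ are the projections of $\mathbb C((\varepsilon))=\mathbb C[[\varepsilon]]\oplus\varepsilon^{-1}\mathbb C[\varepsilon^{-1}]$ on its summands. Define $$N^{\underline\lambda}=-(\text{coefficient of }\varepsilon^{-1}\text{ in }U_-^{\underline\lambda}),\qquad S^{\underline\lambda}=\text{constant term of }U_+^{\underline\lambda}.$$ Theorem. In each of the expansions $$N=\sum_{\underline\lambda\neq\varnothing}N^{\underline\lambda}\,\tfrac1{i\hbar}[B_{\lambda_1},\tfrac1{i\hbar}[B_{\lambda_2},\dots\tfrac1{i\hbar}[B_{\lambda_{r-1}},B_{\lambda_r}]\dots]],$$ $$\Psi(A)=\sum_{\underline\lambda}S^{\underline\lambda}\,\tfrac1{i\hbar}[B_{\lambda_1},\tfrac1{i\hbar}[B_{\lambda_2},\dots\tfrac1{i\hbar}[B_{\lambda_r},A]\dots]]\quad(A\in\mathcal L^{\mathbb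 C}),\qquad C=\sum_{\underline\lambda}\big(\tfrac1{i\hbar}\big)^rS^{\underline\lambda}B_{\lambda_1}\cdots B_{\lambda_r},$$ at each order in $\mu$ only finitely many words give a term that acts nontrivially on a given $e_k$, so that the sums define elements of $\mathcal L^{\mathbb C}$. Moreover $N\in\mathcal L^{\mathbb R}$; $C$ is unitary, that is, $C$ has a formal adjoint $C^*\in\mathcal L^{\mathbb C}$ (taken coefficientwise in $\mu$) and $CC^*=C^*C=1$; $\Psi(A)=CAC^{-1}$ for all $A\in\mathcal L^{\mathbb C}$; and $$\Psi(H_0+B)=H_0+N,\qquad [H_0,N]=0.$$ -/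

import Mathlib

/-! ### Moulds and Birkhoff decomposition

Words on an alphabet `α` are lists; a `K`-valued mould is a function `List α → K`. The field of formal
Laurent series `ℂ((ε))` is `LaurentSeries ℂ`. -/

namespace BirkhoffRS

noncomputable section

/-- Mould multiplication: `(M × N)^w = ∑_{w = a b} M^a N^b`. -/
def mouldMul {α : Type*} (M N : List α → LaurentSeries ℂ) (w : List α) : LaurentSeries ℂ :=
  ∑ i ∈ Finset.range (w.length + 1), M (w.take i) * N (w.drop i)

/-- The polar part of a Laurent series: the projection onto `K₋ = ε⁻¹ℂ[ε⁻¹]` along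
`K₊ = ℂ[[ε]]`. -/
def polarPart (x : LaurentSeries ℂ) : LaurentSeries ℂ :=
  HahnSeries.truncLT (0 : ℤ) x

/-- The regular part of a Laurent series: the projection onto `K₊` along `K₋`. -/
def regularPart (x : LaurentSeries ℂ) : LaurentSeries ℂ :=
  x - polarPart x

/-- The mould
`T^{n₁⋯n_r}(ε) = 1 / ((φ(n₁) + ε) (φ(n₁) + φ(n₂) + 2ε) ⋯ (φ(n₁) + ⋯ + φ(n_r) + rε))`. -/
def mouldT {α : Type*} (φ : α → ℂ) (w : List α) : LaurentSeries ℂ :=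
  ∏ j ∈ Finset.range w.length,
    (HahnSeries.C ((w.take (j + 1)).map φ).sum
      + ((j : LaurentSeries ℂ) + 1) * HahnSeries.single (1 : ℤ) (1 : ℂ))⁻¹

/-- The mould `U₋`: `U₋^∅ = 1`, and `U₋^w` is minus the polar part of
`∑_{w = a b, b ≠ ∅} U₋^a T^b` for `w ≠ ∅`. -/
def birkhoffMinus {α : Type*} (T : List α → LaurentSeries ℂ) (w : List α) : LaurentSeries ℂ :=
  if w = [] then 1
  else -polarPart (∑ i : Fin w.length, birkhoffMinus T (w.take i) * T (w.drop i))
termination_by w.length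
decreasing_by simp

/-- The mould `U₊`: `U₊^∅ = 1`, and `U₊^w` is the regular part of
`∑_{w = a b, b ≠ ∅} U₋^a T^b` for `w ≠ ∅`. -/
def birkhoffPlus {α : Type*} (T : List α → LaurentSeries ℂ) (w : List α) : LaurentSeries ℂ :=
  if w = [] then 1
  else regularPart (∑ i : Fin w.length, birkhoffMinus T (w.take i) * T (w.drop i))

/-- `(Um, Up)` is a Birkhoff decomposition of `T`: `Um^∅ = Up^∅ = 1`, the other values of `Um` lie
in `K₋`, all values of `Up` lie in `K₊`, and `Um × T = Up`. (A Laurent series has finitely many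
negative exponents, so it is in `K₋` as soon as its coefficients of exponent `≥ 0` vanish.) -/
structure IsBirkhoffDecomposition {α : Type*} (T Um Up : List α → LaurentSeries ℂ) : Prop where
  minus_nil : Um [] = 1
  plus_nil : Up [] = 1
  minus_polar : ∀ w, w ≠ [] → ∀ n : ℤ, 0 ≤ n → (Um w).coeff n = 0
  plus_regular : ∀ w, ∀ n : ℤ, n < 0 → (Up w).coeff n = 0
  mul_eq : mouldMul Um T = Up

/-- `N^w`: minus the residue (coefficient of `ε⁻¹`) of `U₋^w`. -/
def mouldN {α : Type*} (φ : α → ℂ) (w : List α) : ℂ :=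
  -(birkhoffMinus (mouldT φ) w).coeff (-1)

/-- `S^w`: the constant term of `U₊^w`. -/
def mouldS {α : Type*} (φ : α → ℂ) (w : List α) : ℂ :=
  (birkhoffPlus (mouldT φ) w).coeff 0

/-! ### Operators on the span of an orthonormal basis -/

variable {H : Type*} [NormedAddCommGroup H] [InnerProductSpace ℂ H] {J : Set ℕ}

/-- `Span_ℂ(e)`, the (algebraic) linear span of the orthonormal basis. -/
abbrev core (e : HilbertBasis J ℂ H) : Submodule ℂ H :=
  Submodule.span ℂ (Set.range e)

/-- Operators whose domain is `Span_ℂ(e)` and which preserve `Span_ℂ(e)`. -/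
abbrev Op (e : HilbertBasis J ℂ H) : Type _ :=
  Module.End ℂ (core e)

/-- The `e_k` as an algebraic basis of their span. -/
def coreBasis (e : HilbertBasis J ℂ H) : Module.Basis J ℂ (core e) :=
  Module.Basis.span e.orthonormal.linearIndependent

theorem coreBasis_coe (e : HilbertBasis J ℂ H) (k : J) : ((coreBasis e k : core e) : H) = e k :=
  congrArg Subtype.val (Module.Basis.span_apply e.orthonormal.linearIndependent k)

/-- The matrix entry `(e_k, A e_l)`. -/
def entry (e : HilbertBasis J ℂ H) (A : Op e) (k l : J) : ℂ :=
  inner ℂ (coreBasis e k) (A (coreBasis e l))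

/-- A (possibly unbounded) operator `H₀` is self-adjoint and diagonal in the orthonormal basis `e`,
with eigenvalues `E₀ k`. -/
structure IsDiagonalIn [CompleteSpace H] (H₀ : H →ₗ.[ℂ] H) (e : HilbertBasis J ℂ H)
    (E₀ : J → ℝ) : Prop where
  selfAdjoint : IsSelfAdjoint H₀
  mem_domain : ∀ k, e k ∈ H₀.domain
  eigen : ∀ k, H₀ ⟨e k, mem_domain k⟩ = (E₀ k : ℂ) • e k

theorem IsDiagonalIn.core_le [CompleteSpace H] {H₀ : H →ₗ.[ℂ] H} {e : HilbertBasis J ℂ H}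
    {E₀ : J → ℝ} (h : IsDiagonalIn H₀ e E₀) : core e ≤ H₀.domain :=
  Submodule.span_le.2 (by rintro _ ⟨k, rfl⟩; exact h.mem_domain k)

theorem IsDiagonalIn.map_core [CompleteSpace H] {H₀ : H →ₗ.[ℂ] H} {e : HilbertBasis J ℂ H}
    {E₀ : J → ℝ} (h : IsDiagonalIn H₀ e E₀) (x : core e) :
    (H₀.toFun.comp (Submodule.inclusion h.core_le)) x ∈ core e := by
  have key : ⊤ ≤ (core e).comap (H₀.toFun.comp (Submodule.inclusion h.core_le)) := by
    rw [← (coreBasis e).span_eq, Submodule.span_le]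
    rintro _ ⟨k, rfl⟩
    have h1 : (H₀.toFun.comp (Submodule.inclusion h.core_le)) (coreBasis e k)
        = (E₀ k : ℂ) • e k := by
      rw [← h.eigen k]
      exact congrArg H₀.toFun (Subtype.ext (coreBasis_coe e k))
    simp only [Submodule.comap_coe, Set.mem_preimage, SetLike.mem_coe]
    rw [h1]
    exact Submodule.smul_mem _ _ (Submodule.subset_span ⟨k, rfl⟩)
  exact key (Submodule.mem_top (x := x))

/-- The restriction of `H₀` to `Span_ℂ(e)`. -/
def IsDiagonalIn.restrict [CompleteSpace H] {H₀ : H →ₗ.[ℂ] H} {e : HilbertBasis J ℂ H}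
    {E₀ : J → ℝ} (h : IsDiagonalIn H₀ e E₀) : Op e :=
  (H₀.toFun.comp (Submodule.inclusion h.core_le)).codRestrict (core e) h.map_core

/-! ### Formal power series in `μ` of operators

Elements of `PowerSeries (Op e)` are the series `∑ μⁿ Aₙ` with `Aₙ : Op e`, with the Cauchy
product; the indeterminate `μ` commutes with everything and is real. -/

/-- All coefficients are symmetric operators. -/
def IsSymmetricSeries (e : HilbertBasis J ℂ H) (A : PowerSeries (Op e)) : Prop :=
  ∀ n, (PowerSeries.coeff n A).IsSymmetric

/-- `A'` is the (coefficientwise) formal adjoint of `A` on `Span_ℂ(e)`. -/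
def IsAdjointSeries (e : HilbertBasis J ℂ H) (A A' : PowerSeries (Op e)) : Prop :=
  ∀ n (x y : core e),
    inner ℂ (PowerSeries.coeff n A x) y = inner ℂ x (PowerSeries.coeff n A' y)

/-- Finite-band: for some `D` all matrix entries `β_{k,l}(μ)` with `|k - l| > D` vanish. -/
def IsFiniteBand (e : HilbertBasis J ℂ H) (A : PowerSeries (Op e)) : Prop :=
  ∃ D : ℕ, ∀ k l : J, (D : ℤ) < |((k : ℕ) : ℤ) - ((l : ℕ) : ℤ)| →
    ∀ n, entry e (PowerSeries.coeff n A) k l = 0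

/-- The bracket `(1 / iħ) (X Y - Y X)`. -/
def qbr (e : HilbertBasis J ℂ H) (ħ : ℝ) (X Y : PowerSeries (Op e)) : PowerSeries (Op e) :=
  (1 / (Complex.I * (ħ : ℂ))) • (X * Y - Y * X)

/-- The right-nested bracket `[X₁, [X₂, … [X_{r-1}, X_r] … ]]` for `qbr`; it is `X₁` if `r = 1`,
and `0` for the empty list. -/
def nestedBr (e : HilbertBasis J ℂ H) (ħ : ℝ) : List (PowerSeries (Op e)) → PowerSeries (Op e)
  | [] => 0
  | [X] => X
  | X :: Y :: l => qbr e ħ X (nestedBr e ħ (Y :: l))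

/-- `[X₁, [X₂, … [X_r, A] … ]]` for `qbr`; it is `A` for the empty list. -/
def iterAd (e : HilbertBasis J ℂ H) (ħ : ℝ) (l : List (PowerSeries (Op e)))
    (A : PowerSeries (Op e)) : PowerSeries (Op e) :=
  l.foldr (qbr e ħ) A

/-- The alphabet: all `λ = (E₀ k - E₀ l) / iħ` with `k, l ∈ J`. -/
def freqs (ħ : ℝ) (E₀ : J → ℝ) : Set ℂ :=
  {z | ∃ k l : J, z = ((E₀ k : ℂ) - (E₀ l : ℂ)) / (Complex.I * (ħ : ℂ))}

open Classical in
/-- The part of the operator `A` with matrix entries `(e_k, A e_l)` for the pairs `(k, l)` such that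
`E₀ k - E₀ l = iħλ`, and `0` for the other pairs. -/
def opComponent (e : HilbertBasis J ℂ H) (ħ : ℝ) (E₀ : J → ℝ) (z : ℂ) (A : Op e) : Op e :=
  (coreBasis e).constr ℂ fun l =>
    (coreBasis e).repr.symm
      (((coreBasis e).repr (A (coreBasis e l))).filter
        fun k => (E₀ k : ℂ) - (E₀ l : ℂ) = Complex.I * (ħ : ℂ) * z)

/-- The component `B_λ`, taken coefficientwise in `μ`. -/
def component (e : HilbertBasis J ℂ H) (ħ : ℝ) (E₀ : J → ℝ) (B : PowerSeries (Op e)) (z : ℂ) :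
    PowerSeries (Op e) :=
  PowerSeries.mk fun n => opComponent e ħ E₀ z (PowerSeries.coeff n B)

/-- The letters of a word replaced by the corresponding components of `B`. -/
def components (e : HilbertBasis J ℂ H) (ħ : ℝ) (E₀ : J → ℝ) (B : PowerSeries (Op e))
    (w : List (freqs ħ E₀)) : List (PowerSeries (Op e)) :=
  w.map fun z => component e ħ E₀ B (z : ℂ)

/-- A family of series is formally summable: at each order in `μ`, only finitely many members of the
family act nontrivially on any given basis vector. -/
def FormallySummable {ι : Type*} (e : HilbertBasis J ℂ H) (F : ι → PowerSeries (Op e)) : Prop :=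
  ∀ n (k : J), {i | PowerSeries.coeff n (F i) (coreBasis e k) ≠ 0}.Finite

/-- The sum of a formally summable family: at each order in `μ`, the operator that maps each `e_k`
to the finite sum of its images. -/
def formalSum {ι : Type*} (e : HilbertBasis J ℂ H) (F : ι → PowerSeries (Op e)) :
    PowerSeries (Op e) :=
  PowerSeries.mk fun n =>
    (coreBasis e).constr ℂ fun k => ∑ᶠ i, PowerSeries.coeff n (F i) (coreBasis e k)

/-- The terms of the expansion of `N`. -/
def termN (e : HilbertBasis J ℂ H) (ħ : ℝ) (E₀ : J → ℝ) (B : PowerSeries (Op e))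
    (w : List (freqs ħ E₀)) : PowerSeries (Op e) :=
  mouldN (fun z : freqs ħ E₀ => (z : ℂ)) w • nestedBr e ħ (components e ħ E₀ B w)

/-- The terms of the expansion of `Ψ(A)`. -/
def termPsi (e : HilbertBasis J ℂ H) (ħ : ℝ) (E₀ : J → ℝ) (B A : PowerSeries (Op e))
    (w : List (freqs ħ E₀)) : PowerSeries (Op e) :=
  mouldS (fun z : freqs ħ E₀ => (z : ℂ)) w • iterAd e ħ (components e ħ E₀ B w) A

/-- The terms of the expansion of `C`. -/
def termC (e : HilbertBasis J ℂ H) (ħ : ℝ) (E₀ : J → ℝ) (B : PowerSeries (Op e))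
    (w : List (freqs ħ E₀)) : PowerSeries (Op e) :=
  ((1 / (Complex.I * (ħ : ℂ))) ^ w.length * mouldS (fun z : freqs ħ E₀ => (z : ℂ)) w) •
    (components e ħ E₀ B w).prod

/-- `N = ∑_w N^w (1/iħ)[B_{λ₁}, (1/iħ)[B_{λ₂}, … (1/iħ)[B_{λ_{r-1}}, B_{λ_r}] … ]]`. -/
def normalForm (e : HilbertBasis J ℂ H) (ħ : ℝ) (E₀ : J → ℝ) (B : PowerSeries (Op e)) :
    PowerSeries (Op e) :=
  formalSum e (termN e ħ E₀ B)

/-- `Ψ(A) = ∑_w S^w (1/iħ)[B_{λ₁}, (1/iħ)[B_{λ₂}, … (1/iħ)[B_{λ_r}, A] … ]]`. -/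
def Psi (e : HilbertBasis J ℂ H) (ħ : ℝ) (E₀ : J → ℝ) (B A : PowerSeries (Op e)) :
    PowerSeries (Op e) :=
  formalSum e (termPsi e ħ E₀ B A)

/-- `C = ∑_w (1/iħ)^r S^w B_{λ₁} B_{λ₂} ⋯ B_{λ_r}`. -/
def conjC (e : HilbertBasis J ℂ H) (ħ : ℝ) (E₀ : J → ℝ) (B : PowerSeries (Op e)) :
    PowerSeries (Op e) :=
  formalSum e (termC e ħ E₀ B)

end

end BirkhoffRS

/-! Give the letter `x` the weight `φ x + ε`, and let `nabla` multiply a mould by the total weight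
of the word. Then `T` is the solution of `∇T = T × I`, with `I` the indicator of one-letter words.
All weights of nonempty words are invertible, so this equation makes `T` symmetral.

A mould with polar values whose product with `T` is regular must vanish
(`eq_zero_of_convol_regular`). This principle is used three times: for uniqueness of the Birkhoff
decomposition, in its dimould form for symmetrality of both factors, and for the identity `(rN) × U₋
+ ∇U₋ = 0`, with `r` the length of the word. Multiplying that identity by `T` and taking constant
terms gives the mould equation `∇S = S × I - (rN) × S` (`nabla_mouldS`), where the weights are now
the `φ x`. It also forces `N` to live on words of total weight zero (`resonant`). The residue of a
product of two polar series vanishes, so `N` is alternal, while `S` is symmetral.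

On the operator side, put `b_λ = B_λ / iħ`. A mould `M` is sent to `∑ M^w b_w`; mould products
become operator products, and `∇` becomes the commutator with `H₀ / iħ`. Symmetrality of `S` turns
the expansion of `Ψ` into a conjugation `A ↦ C A C'`, with `C'` the expansion of the antipode of `S`
(`IsSymmetral.sum_iterComm`). Alternality of `N` turns nested brackets into `r` times plain products
(Dynkin), which is where the factor `r` above comes from. Thus `nabla_mouldS` says `[H₀, C] = C B -
N C`, that is `C (H₀ + B) = (H₀ + N) C`, and resonance says `[H₀, N] = 0`. Unitarity follows from
`B_λ* = B_{λ̄}` and the compatibility of `S` with complex conjugation, and symmetry of `N` from `N =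
C (H₀ + B) C* - H₀`.

The sums make sense because each letter has order at least one in `μ`, which bounds the length of
the words at a given order, and because only finitely many `B_λ` act on a given vector at a given
order. Identities are proved on finite sets of letters and passed to the limit. -/

namespace BirkhoffRS

open Finset

/-! ### Mould algebra: products and the weight derivation -/

section Convolution

variable {α R : Type*} [CommRing R]

/-- Mould multiplication with values in a commutative ring. -/
def convol (M N : List α → R) (w : List α) : R :=
  ∑ i ∈ range (w.length + 1), M (w.take i) * N (w.drop i)

/-- The mould obtained by prescribing the first letter. -/
def lder (x : α) (M : List α → R) : List α → R := fun w => M (x :: w)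

theorem convol_nil (M N : List α → R) : convol M N [] = M [] * N [] := by
  simp [convol]

theorem convol_cons (M N : List α → R) (x : α) (w : List α) :
    convol M N (x :: w) = convol (lder x M) N w + M [] * N (x :: w) := by
  rw [convol, List.length_cons, sum_range_succ']
  rfl

/-- A twisted Leibniz rule: the first letter belongs to the second factor only when the prefix is
empty. It replaces manipulations of splittings by induction on words. -/
theorem lder_convol (M N : List α → R) (x : α) :
    lder x (convol M N) = convol (lder x M) N + fun w => M [] * lder x N w := by
  funext w
  exact convol_cons M N x w

theorem convol_add_left (M M' N : List α → R) :
    convol (M + M') N = convol M N + convol M' N := by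
  funext w
  simp [convol, add_mul, sum_add_distrib]

theorem convol_sub_left (M M' N : List α → R) :
    convol (M - M') N = convol M N - convol M' N := by
  funext w
  simp [convol, sub_mul, sum_sub_distrib]

theorem convol_smul_left (c : R) (M N : List α → R) :
    convol (fun w => c * M w) N = fun w => c * convol M N w := by
  funext w
  simp [convol, mul_sum, mul_assoc]

theorem convol_assoc (M N P : List α → R) :
    convol (convol M N) P = convol M (convol N P) := by
  funext w
  induction w generalizing M N P with
  | nil => simp [convol_nil, mul_assoc]
  | cons x w ih =>
    rw [convol_cons, convol_cons M, convol_nil, lder_convol, convol_add_left, Pi.add_apply, ih,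
      convol_smul_left, convol_cons]
    ring

/-- If `D` vanishes on words shorter than `w`, only the full prefix contributes. -/
theorem convol_eq_of_shorter (D N : List α → R) (w : List α)
    (h : ∀ u, u.length < w.length → D u = 0) : convol D N w = D w * N [] := by
  rw [convol, sum_range_succ, sum_eq_zero, zero_add, List.take_length, List.drop_length]
  intro i hi
  rw [mem_range] at hi
  rw [h _ (by simpa using hi), zero_mul]

/-- The mould supported on words of length one, with value `1` there. -/
def mouldI (w : List α) : R := if w.length = 1 then 1 else 0

theorem convol_mouldI (M : List α → R) (w : List α) (x : α) :
    convol M mouldI (w ++ [x]) = M w := by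
  rw [convol, sum_eq_single w.length]
  · simp [mouldI]
  · intro i hi hne
    rw [mem_range] at hi
    simp only [List.length_append, List.length_singleton] at hi
    have : ((w ++ [x]).drop i).length ≠ 1 := by
      simp only [List.length_drop, List.length_append, List.length_singleton]
      omega
    rw [mouldI, if_neg this, mul_zero]
  · simp

/-- The derivation multiplying the value at a word by its total weight. -/
def nabla (wt : α → R) (M : List α → R) (w : List α) : R := (w.map wt).sum * M w

/-- The total weight is additive under concatenation. -/
theorem nabla_convol (wt : α → R) (M N : List α → R) :
    nabla wt (convol M N) = convol (nabla wt M) N + convol M (nabla wt N) := by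
  funext w
  simp only [nabla, convol, Pi.add_apply, mul_sum, ← sum_add_distrib]
  refine sum_congr rfl fun i _ => ?_
  conv_lhs => rw [← List.take_append_drop i w, List.map_append, List.sum_append,
    List.take_append_drop]
  ring

end Convolution

/-! ### Shuffles, dimoulds, symmetral and alternal moulds -/

section Shuffle

variable {α R : Type*} [CommRing R]

/-- Dimould multiplication. -/
def diConvol (G K : List α → List α → R) (u v : List α) : R :=
  ∑ i ∈ range (u.length + 1), ∑ j ∈ range (v.length + 1),
    G (u.take i) (v.take j) * K (u.drop i) (v.drop j)

/-- The sum of the values of a mould over all shuffles of two words. -/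
def shuffleSum : (List α → R) → List α → List α → R
  | M, [], [] => M []
  | M, x :: u, [] => shuffleSum (lder x M) u []
  | M, [], y :: v => shuffleSum (lder y M) [] v
  | M, x :: u, y :: v => shuffleSum (lder x M) u (y :: v) + shuffleSum (lder y M) (x :: u) v
termination_by _ u v => u.length + v.length

/-- A family of dimoulds indexed by the first letter of the left word. -/
def onLeft (G : α → List α → List α → R) : List α → List α → R
  | [], _ => 0
  | x :: u, v => G x u v

/-- A family of dimoulds indexed by the first letter of the right word. -/
def onRight (G : α → List α → List α → R) : List α → List α → R
  | _, [] => 0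
  | u, y :: v => G y u v

/-- The dimould supported on the pair of empty words. -/
def diUnit (c : R) : List α → List α → R
  | [], [] => c
  | _, _ => 0

/-- The first letter of a shuffle comes from one of the two words. Stated as one identity between
dimoulds, so that it can be multiplied by a dimould or expanded in operators. -/
theorem shuffleSum_eq (M : List α → R) :
    shuffleSum M = diUnit (M []) + onLeft (fun x => shuffleSum (lder x M)) +
      onRight (fun x => shuffleSum (lder x M)) := by
  funext u v
  rcases u with _ | ⟨x, u⟩ <;> rcases v with _ | ⟨y, v⟩ <;>
    simp [shuffleSum, diUnit, onLeft, onRight]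

theorem diConvol_add_left (G G' K : List α → List α → R) :
    diConvol (G + G') K = diConvol G K + diConvol G' K := by
  funext u v
  simp [diConvol, add_mul, sum_add_distrib]

theorem diConvol_add_right (G K K' : List α → List α → R) :
    diConvol G (K + K') = diConvol G K + diConvol G K' := by
  funext u v
  simp [diConvol, mul_add, sum_add_distrib]

theorem diConvol_sub_left (G G' K : List α → List α → R) :
    diConvol (G - G') K = diConvol G K - diConvol G' K := by
  funext u v
  simp [diConvol, sub_mul, sum_sub_distrib]

theorem diConvol_onLeft (G : α → List α → List α → R) (K : List α → List α → R) :
    diConvol (onLeft G) K = onLeft fun x => diConvol (G x) K := by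
  funext u v
  rcases u with _ | ⟨x, u⟩
  · simp [diConvol, onLeft]
  · rw [diConvol, List.length_cons, sum_range_succ']
    simp [onLeft, diConvol]

theorem diConvol_onRight (G : α → List α → List α → R) (K : List α → List α → R) :
    diConvol (onRight G) K = onRight fun x => diConvol (G x) K := by
  funext u v
  rcases v with _ | ⟨y, v⟩
  · simp [diConvol, onRight]
  · simp only [diConvol, List.length_cons, onRight]
    refine sum_congr rfl fun i _ => ?_
    rw [sum_range_succ']
    simp

theorem diConvol_diUnit (c : R) (K : List α → List α → R) :
    diConvol (diUnit c) K = fun u v => c * K u v := by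
  funext u v
  rw [diConvol, sum_range_succ', sum_eq_zero, zero_add, sum_range_succ', sum_eq_zero, zero_add]
  · simp [diUnit]
  · intro j hj
    rw [mem_range] at hj
    rcases v with _ | ⟨y, v⟩
    · simp at hj
    · simp [diUnit]
  · intro i hi
    rw [mem_range] at hi
    rcases u with _ | ⟨x, u⟩
    · simp at hi
    · simp [diUnit]

theorem shuffleSum_add (M N : List α → R) (u v : List α) :
    shuffleSum (M + N) u v = shuffleSum M u v + shuffleSum N u v := by
  induction h : u.length + v.length generalizing u v M N with
  | zero =>
    obtain ⟨rfl, rfl⟩ : u = [] ∧ v = [] := by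
      simpa using h
    simp [shuffleSum]
  | succ n ih =>
    have hl : ∀ x, lder x (M + N) = lder x M + lder x N := fun _ => rfl
    rcases u with _ | ⟨x, u⟩ <;> rcases v with _ | ⟨y, v⟩ <;>
      simp only [List.length_cons, List.length_nil] at h
    · omega
    · simp only [shuffleSum, hl]
      rw [ih _ _ _ _ (by simp only [List.length_nil]; omega)]
    · simp only [shuffleSum, hl]
      rw [ih _ _ _ _ (by simp only [List.length_nil]; omega)]
    · simp only [shuffleSum, hl]
      rw [ih _ _ _ _ (by simp only [List.length_cons]; omega),
        ih _ _ _ _ (by simp only [List.length_cons]; omega)]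
      ring

/-- Additive maps commute with shuffle sums. -/
theorem shuffleSum_map {S : Type*} [CommRing S] (f : R →+ S) (M : List α → R) (u v : List α) :
    shuffleSum (fun w => f (M w)) u v = f (shuffleSum M u v) := by
  induction h : u.length + v.length generalizing u v M with
  | zero =>
    obtain ⟨rfl, rfl⟩ : u = [] ∧ v = [] := by simpa using h
    simp [shuffleSum]
  | succ n ih =>
    have hl : ∀ x, lder x (fun w => f (M w)) = fun w => f (lder x M w) := fun _ => rfl
    rcases u with _ | ⟨x, u⟩ <;> rcases v with _ | ⟨y, v⟩ <;>
      simp only [List.length_cons, List.length_nil] at h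
    · omega
    · simp only [shuffleSum, hl]
      rw [ih _ _ _ (by simp only [List.length_nil]; omega)]
    · simp only [shuffleSum, hl]
      rw [ih _ _ _ (by simp only [List.length_nil]; omega)]
    · simp only [shuffleSum, hl]
      rw [ih _ _ _ (by simp only [List.length_cons]; omega),
        ih _ _ _ (by simp only [List.length_cons]; omega), map_add]

/-- A shuffle sum lies in every additive subgroup that contains the values at the words of the
appropriate length. -/
theorem shuffleSum_mem (A : AddSubgroup R) (M : List α → R) (u v : List α)
    (hM : ∀ w, w.length = u.length + v.length → M w ∈ A) : shuffleSum M u v ∈ A := by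
  induction h : u.length + v.length generalizing u v M with
  | zero =>
    obtain ⟨rfl, rfl⟩ : u = [] ∧ v = [] := by simpa using h
    simpa [shuffleSum] using hM [] rfl
  | succ n ih =>
    rcases u with _ | ⟨x, u⟩ <;> rcases v with _ | ⟨y, v⟩ <;>
      simp only [List.length_cons, List.length_nil] at h
    · omega
    · simp only [shuffleSum]
      refine ih _ _ _ (fun w hw => hM _ ?_) (by simp only [List.length_nil]; omega)
      simp only [List.length_cons, List.length_nil] at hw ⊢; omega
    · simp only [shuffleSum]
      refine ih _ _ _ (fun w hw => hM _ ?_) (by simp only [List.length_nil]; omega)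
      simp only [List.length_cons, List.length_nil] at hw ⊢; omega
    · simp only [shuffleSum]
      refine A.add_mem (ih _ _ _ (fun w hw => hM _ ?_) (by simp only [List.length_cons]; omega))
        (ih _ _ _ (fun w hw => hM _ ?_) (by simp only [List.length_cons]; omega)) <;>
      · simp only [List.length_cons] at hw ⊢; omega

theorem shuffleSum_mul_left (c : R) (M : List α → R) (u v : List α) :
    shuffleSum (fun w => c * M w) u v = c * shuffleSum M u v :=
  shuffleSum_map (AddMonoidHom.mulLeft c) M u v

/-- Shuffle sums turn mould multiplication into dimould multiplication. -/
theorem shuffleSum_convol (M N : List α → R) (u v : List α) :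
    shuffleSum (convol M N) u v = diConvol (shuffleSum M) (shuffleSum N) u v := by
  induction h : u.length + v.length generalizing u v M N with
  | zero =>
    obtain ⟨rfl, rfl⟩ : u = [] ∧ v = [] := by simpa using h
    simp [shuffleSum, diConvol, convol]
  | succ n ih =>
    rw [shuffleSum_eq M, diConvol_add_left, diConvol_add_left, diConvol_diUnit, diConvol_onLeft,
      diConvol_onRight]
    have key : ∀ x u v, u.length + v.length = n → shuffleSum (lder x (convol M N)) u v =
        diConvol (shuffleSum (lder x M)) (shuffleSum N) u v +
          M [] * shuffleSum (lder x N) u v := by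
      intro x u v huv
      rw [lder_convol, shuffleSum_add, ih _ _ _ _ huv, shuffleSum_mul_left]
    simp only [Pi.add_apply]
    rcases u with _ | ⟨x, u⟩ <;> rcases v with _ | ⟨y, v⟩ <;>
      simp only [List.length_cons, List.length_nil] at h
    · omega
    · simp only [shuffleSum, onLeft, onRight]
      rw [key _ _ _ (by simp only [List.length_nil]; omega)]
      ring
    · simp only [shuffleSum, onLeft, onRight]
      rw [key _ _ _ (by simp only [List.length_nil]; omega)]
      ring
    · simp only [shuffleSum, onLeft, onRight]
      rw [key _ _ _ (by simp only [List.length_cons]; omega),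
        key _ _ _ (by simp only [List.length_cons]; omega)]
      ring

/-- All shuffles of `u` and `v` have the same letters, hence the same total weight. -/
theorem shuffleSum_nabla (wt : α → R) (M : List α → R) (u v : List α) :
    shuffleSum (nabla wt M) u v = ((u.map wt).sum + (v.map wt).sum) * shuffleSum M u v := by
  induction h : u.length + v.length generalizing u v M with
  | zero =>
    obtain ⟨rfl, rfl⟩ : u = [] ∧ v = [] := by simpa using h
    simp [shuffleSum, nabla]
  | succ n ih =>
    have hl : ∀ x, lder x (nabla wt M) =
        nabla wt (lder x M) + fun w => wt x * lder x M w := by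
      intro x
      funext w
      simp [lder, nabla, add_mul, add_comm]
    rcases u with _ | ⟨x, u⟩ <;> rcases v with _ | ⟨y, v⟩ <;>
      simp only [List.length_cons, List.length_nil] at h
    · omega
    · simp only [shuffleSum, hl, shuffleSum_add, shuffleSum_mul_left]
      rw [ih _ _ _ (by simp only [List.length_nil]; omega)]
      simp only [List.map_cons, List.sum_cons, List.map_nil, List.sum_nil]
      ring
    · simp only [shuffleSum, hl, shuffleSum_add, shuffleSum_mul_left]
      rw [ih _ _ _ (by simp only [List.length_nil]; omega)]
      simp only [List.map_cons, List.sum_cons, List.map_nil, List.sum_nil]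
      ring
    · simp only [shuffleSum, hl, shuffleSum_add, shuffleSum_mul_left]
      rw [ih _ _ _ (by simp only [List.length_cons]; omega),
        ih _ _ _ (by simp only [List.length_cons]; omega)]
      simp only [List.map_cons, List.sum_cons]
      ring

/-- The tensor product of two moulds. -/
def tensor (M N : List α → R) (u v : List α) : R := M u * N v

theorem diConvol_tensor (M M' N N' : List α → R) (u v : List α) :
    diConvol (tensor M M') (tensor N N') u v = convol M N u * convol M' N' v := by
  simp only [diConvol, tensor, convol, sum_mul_sum]
  refine sum_congr rfl fun i _ => sum_congr rfl fun j _ => ?_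
  ring

/-- If `D` vanishes on pairs of smaller total length, only the full prefixes contribute. -/
theorem diConvol_eq_of_shorter (D K : List α → List α → R) (u v : List α)
    (h : ∀ u' v', u'.length + v'.length < u.length + v.length → D u' v' = 0) :
    diConvol D K u v = D u v * K [] [] := by
  rw [diConvol, sum_range_succ, sum_eq_zero, zero_add, sum_range_succ, sum_eq_zero, zero_add,
    List.take_length, List.drop_length, List.take_length, List.drop_length]
  · intro j hj
    rw [mem_range] at hj
    rw [h _ _ (by simp only [List.length_take]; omega), zero_mul]
  · intro i hi
    rw [mem_range] at hi
    refine sum_eq_zero fun j _ => ?_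
    rw [h _ _ (by simp only [List.length_take]; omega), zero_mul]

/-- A mould is symmetral if its shuffle sums are products. -/
def IsSymmetral (M : List α → R) : Prop := ∀ u v, shuffleSum M u v = M u * M v

/-- A mould is alternal if its shuffle sums over pairs of nonempty words vanish. -/
def IsAlternal (M : List α → R) : Prop :=
  M [] = 0 ∧ ∀ u v, u ≠ [] → v ≠ [] → shuffleSum M u v = 0

theorem shuffleSum_nil_left (M : List α → R) (v : List α) : shuffleSum M [] v = M v := by
  induction v generalizing M with
  | nil => simp [shuffleSum]
  | cons y v ih => rw [shuffleSum, ih]; rfl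

theorem shuffleSum_nil_right (M : List α → R) (u : List α) : shuffleSum M u [] = M u := by
  induction u generalizing M with
  | nil => simp [shuffleSum]
  | cons y v ih => rw [shuffleSum, ih]; rfl

/-- The mould whose value at the empty word is `1` and whose other values are `0`. -/
def mouldOne (w : List α) : R := if w.length = 0 then 1 else 0

theorem convol_mouldOne (M : List α → R) : convol M mouldOne = M := by
  funext w
  rw [convol, sum_range_succ, sum_eq_zero]
  · simp [mouldOne]
  · intro i hi
    rw [mem_range] at hi
    rw [mouldOne, if_neg, mul_zero]
    simp only [List.length_drop]; omega

theorem shuffleSum_mouldI :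
    shuffleSum (mouldI : List α → R) = tensor mouldI mouldOne + tensor mouldOne mouldI := by
  funext u v
  rcases u with _ | ⟨x, u⟩
  · rw [shuffleSum_nil_left]; simp [tensor, mouldI, mouldOne]
  rcases v with _ | ⟨y, v⟩
  · rw [shuffleSum_nil_right]; simp [tensor, mouldI, mouldOne]
  -- Shuffles of two nonempty words have length at least two, where `mouldI` vanishes; membership in
  -- the trivial subgroup expresses this.
  · have : shuffleSum (mouldI : List α → R) (x :: u) (y :: v) ∈ (⊥ : AddSubgroup R) := by
      refine shuffleSum_mem _ _ _ _ fun w hw => ?_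
      simp only [List.length_cons] at hw
      rw [AddSubgroup.mem_bot, mouldI, if_neg (by omega)]
    rw [AddSubgroup.mem_bot] at this
    simp [this, tensor, mouldOne]

/-- A mould solving `∇ M = M × I` with nonvanishing weights is symmetral. -/
theorem IsSymmetral.of_nabla_eq [IsDomain R] (wt : α → R) (M : List α → R)
    (hwt : ∀ w : List α, w ≠ [] → (w.map wt).sum ≠ 0) (h1 : M [] = 1)
    (hM : nabla wt M = convol M mouldI) : IsSymmetral M := by
  intro u v
  induction h : u.length + v.length using Nat.strong_induction_on generalizing u v with
  | _ n ih =>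
  by_cases huv : u ++ v = []
  · obtain ⟨rfl, rfl⟩ := List.append_eq_nil_iff.1 huv
    simp [shuffleSum, h1]
  have hne := hwt _ huv
  rw [List.map_append, List.sum_append] at hne
  -- By induction only the full prefixes could contribute, and they meet `shuffleSum mouldI [] [] =
  -- 0`. On the other hand, right multiplication by `shuffleSum mouldI` multiplies both `shuffleSum
  -- M` and `tensor M M` by the total weight of `u` and `v`, which can be cancelled.
  have h2 : diConvol (shuffleSum M - tensor M M) (shuffleSum mouldI) u v = 0 := by
    rw [diConvol_eq_of_shorter]
    · simp [shuffleSum, mouldI]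
    · intro u' v' hlt
      rw [Pi.sub_apply, Pi.sub_apply, ih _ (h ▸ hlt) u' v' rfl, tensor, sub_self]
  rw [diConvol_sub_left, Pi.sub_apply, Pi.sub_apply, ← shuffleSum_convol, ← hM, shuffleSum_nabla,
    shuffleSum_mouldI, diConvol_add_right, Pi.add_apply, Pi.add_apply, diConvol_tensor,
    diConvol_tensor, convol_mouldOne, ← hM] at h2
  refine mul_left_cancel₀ hne ?_
  rw [sub_eq_zero] at h2
  rw [h2, nabla, nabla]
  ring

end Shuffle

/-! ### Polar and regular Laurent series; symmetrality of `T` -/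

section Laurent

/-- Laurent series in `ε⁻¹ℂ[ε⁻¹]`. -/
def polarSubgroup : AddSubgroup (LaurentSeries ℂ) where
  carrier := {x | ∀ n : ℤ, 0 ≤ n → x.coeff n = 0}
  zero_mem' := by simp
  add_mem' := fun hx hy n hn => by simp [hx n hn, hy n hn]
  neg_mem' := fun hx n hn => by simp [hx n hn]

/-- Laurent series in `ℂ[[ε]]`. -/
def regularSubring : Subring (LaurentSeries ℂ) where
  carrier := {x | ∀ n : ℤ, n < 0 → x.coeff n = 0}
  zero_mem' := by simp
  one_mem' := fun n hn => by simp [HahnSeries.coeff_one, hn.ne]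
  add_mem' := fun hx hy n hn => by simp [hx n hn, hy n hn]
  neg_mem' := fun hx n hn => by simp [hx n hn]
  mul_mem' := fun {x y} hx hy n hn => by
    rw [HahnSeries.coeff_mul]
    refine sum_eq_zero fun ij hij => ?_
    rw [Finset.mem_antidiagonal] at hij
    obtain h | h : ij.1 < 0 ∨ ij.2 < 0 := by omega
    · rw [hx _ h, zero_mul]
    · rw [hy _ h, mul_zero]

theorem coeff_mul_of_polar {x y : LaurentSeries ℂ} (hx : x ∈ polarSubgroup)
    (hy : y ∈ polarSubgroup) (n : ℤ) (hn : -1 ≤ n) : (x * y).coeff n = 0 := by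
  rw [HahnSeries.coeff_mul]
  refine sum_eq_zero fun ij hij => ?_
  rw [Finset.mem_antidiagonal] at hij
  obtain h | h : 0 ≤ ij.1 ∨ 0 ≤ ij.2 := by omega
  · rw [hx _ h, zero_mul]
  · rw [hy _ h, mul_zero]

theorem coeff_zero_mul_of_regular {x y : LaurentSeries ℂ} (hx : x ∈ regularSubring)
    (hy : y ∈ regularSubring) : (x * y).coeff 0 = x.coeff 0 * y.coeff 0 := by
  rw [HahnSeries.coeff_mul, sum_eq_single (0, 0)]
  · rintro ⟨i, j⟩ hij hne
    rw [Finset.mem_antidiagonal] at hij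
    obtain h | h : i < 0 ∨ j < 0 := by
      by_contra! hcon
      refine hne (Prod.ext ?_ ?_) <;> simp only at hij ⊢ <;> omega
    · rw [hx _ h, zero_mul]
    · rw [hy _ h, mul_zero]
  · intro h
    rw [Finset.mem_antidiagonal] at h
    simp only [HahnSeries.mem_support, add_zero, and_true, not_and_or, not_not] at h
    rcases h with h | h
    · rw [h, zero_mul]
    · rw [h, mul_zero]

theorem eq_zero_of_polar_of_regular {x : LaurentSeries ℂ} (hx : x ∈ polarSubgroup)
    (hy : x ∈ regularSubring) : x = 0 := by
  ext n
  rcases lt_or_ge n 0 with h | h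
  · rw [hy n h, HahnSeries.coeff_zero]
  · rw [hx n h, HahnSeries.coeff_zero]

theorem polarPart_mem (x : LaurentSeries ℂ) : polarPart x ∈ polarSubgroup := fun n hn => by
  rw [polarPart, HahnSeries.coeff_truncLT, if_neg hn.not_gt]

theorem regularPart_mem (x : LaurentSeries ℂ) : regularPart x ∈ regularSubring := fun n hn => by
  rw [regularPart, polarPart, HahnSeries.coeff_sub, HahnSeries.coeff_truncLT, if_pos hn, sub_self]

theorem coeff_laurentC (c : ℂ) (n : ℤ) :
    (HahnSeries.C c : LaurentSeries ℂ).coeff n = if n = 0 then c else 0 := by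
  rw [HahnSeries.C_apply, HahnSeries.coeff_single]
  congr

/-- The weight of a letter in the mould `T`. -/
noncomputable def laurentWeight {α : Type*} (φ : α → ℂ) (x : α) : LaurentSeries ℂ :=
  HahnSeries.C (φ x) + HahnSeries.single (1 : ℤ) (1 : ℂ)

theorem laurentWeight_sum {α : Type*} (φ : α → ℂ) (w : List α) :
    (w.map (laurentWeight φ)).sum =
      HahnSeries.C (w.map φ).sum + (w.length : LaurentSeries ℂ) * HahnSeries.single (1 : ℤ) 1 := by
  induction w with
  | nil => simp
  | cons x w ih =>
    simp only [List.map_cons, List.sum_cons, ih, List.length_cons, laurentWeight, map_add]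
    push_cast
    ring

/-- The summand `rε` of the weight shifts coefficients by one. This shift is how the residue of `U₋`
enters the constant terms. -/
theorem coeff_laurentWeight_sum_mul {α : Type*} (φ : α → ℂ) (w : List α) (x : LaurentSeries ℂ)
    (n : ℤ) : ((w.map (laurentWeight φ)).sum * x).coeff n =
      (w.map φ).sum * x.coeff n + w.length * x.coeff (n - 1) := by
  rw [laurentWeight_sum, add_mul, HahnSeries.coeff_add, HahnSeries.C_mul_eq_smul,
    HahnSeries.coeff_smul, smul_eq_mul, mul_assoc,
    show (w.length : LaurentSeries ℂ) = HahnSeries.C (w.length : ℂ) by simp,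
    HahnSeries.C_mul_eq_smul, HahnSeries.coeff_smul, smul_eq_mul, HahnSeries.coeff_single_mul,
    one_mul]

theorem laurentWeight_sum_ne_zero {α : Type*} (φ : α → ℂ) (w : List α) (hw : w ≠ []) :
    (w.map (laurentWeight φ)).sum ≠ 0 := by
  intro h
  -- The coefficient of `ε` in the weight is the length of the word, nonzero even when the
  -- `φ`-weights cancel.
  have h1 := coeff_laurentWeight_sum_mul φ w 1 1
  rw [h, zero_mul, HahnSeries.coeff_zero] at h1
  exact hw (by simpa [HahnSeries.coeff_one, eq_comm] using h1)

theorem mouldT_append_singleton {α : Type*} (φ : α → ℂ) (w : List α) (x : α) :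
    mouldT φ (w ++ [x]) = mouldT φ w * (((w ++ [x]).map (laurentWeight φ)).sum)⁻¹ := by
  rw [mouldT, List.length_append, List.length_singleton, prod_range_succ]
  congr 1
  · refine prod_congr rfl fun j hj => ?_
    rw [mem_range] at hj
    rw [List.take_append_of_le_length (by omega)]
  · rw [laurentWeight_sum, List.take_of_length_le (by simp)]
    simp

/-- Appending a letter divides `T` by the total weight of the extended word. -/
theorem nabla_mouldT {α : Type*} (φ : α → ℂ) :
    nabla (laurentWeight φ) (mouldT φ) = convol (mouldT φ) mouldI := by
  funext w
  induction w using List.reverseRecOn with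
  | nil => simp [nabla, convol_nil, mouldI]
  | append_singleton w x =>
    rw [convol_mouldI, nabla, mouldT_append_singleton, mul_comm, mul_assoc, inv_mul_cancel₀,
      mul_one]
    exact laurentWeight_sum_ne_zero φ _ (by simp)

theorem mouldT_nil {α : Type*} (φ : α → ℂ) : mouldT φ [] = 1 := by simp [mouldT]

theorem isSymmetral_mouldT {α : Type*} (φ : α → ℂ) : IsSymmetral (mouldT φ) :=
  .of_nabla_eq _ _ (laurentWeight_sum_ne_zero φ) (mouldT_nil φ) (nabla_mouldT φ)

end Laurent

/-! ### Birkhoff decomposition: existence, uniqueness, symmetrality -/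

section Birkhoff

variable {α : Type*} {T : List α → LaurentSeries ℂ}

theorem birkhoffMinus_nil : birkhoffMinus T [] = 1 := by
  rw [birkhoffMinus, if_pos rfl]

theorem birkhoffPlus_nil : birkhoffPlus T [] = 1 := by
  rw [birkhoffPlus, if_pos rfl]

theorem birkhoffMinus_mem (w : List α) (hw : w ≠ []) : birkhoffMinus T w ∈ polarSubgroup := by
  rw [birkhoffMinus, if_neg hw]
  exact neg_mem (polarPart_mem _)

theorem birkhoffPlus_mem (w : List α) : birkhoffPlus T w ∈ regularSubring := by
  by_cases hw : w = []
  · rw [hw, birkhoffPlus_nil]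
    exact one_mem _
  · rw [birkhoffPlus, if_neg hw]
    exact regularPart_mem _

theorem birkhoff_convol (hT : T [] = 1) : convol (birkhoffMinus T) T = birkhoffPlus T := by
  funext w
  by_cases hw : w = []
  · rw [hw, convol_nil, birkhoffMinus_nil, birkhoffPlus_nil, hT, mul_one]
  · rw [birkhoffPlus, if_neg hw, convol, sum_range_succ, List.take_length, List.drop_length, hT,
      mul_one, ← Fin.sum_univ_eq_sum_range (fun i => birkhoffMinus T (w.take i) * T (w.drop i))]
    conv_lhs => enter [2]; rw [birkhoffMinus, if_neg hw]
    rw [regularPart, sub_eq_add_neg]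

theorem isBirkhoffDecomposition (hT : T [] = 1) :
    IsBirkhoffDecomposition T (birkhoffMinus T) (birkhoffPlus T) where
  minus_nil := birkhoffMinus_nil
  plus_nil := birkhoffPlus_nil
  minus_polar := birkhoffMinus_mem
  plus_regular := birkhoffPlus_mem
  mul_eq := birkhoff_convol hT

/-- A polar mould whose product with `T` is regular vanishes. -/
theorem eq_zero_of_convol_regular (hT : T [] = 1) (D : List α → LaurentSeries ℂ)
    (hD : ∀ w, D w ∈ polarSubgroup) (hDT : ∀ w, convol D T w ∈ regularSubring) : D = 0 := by
  funext w
  induction h : w.length using Nat.strong_induction_on generalizing w with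
  | _ n ih =>
  refine eq_zero_of_polar_of_regular (hD w) ?_
  have h1 := hDT w
  rwa [convol_eq_of_shorter _ _ _ (fun u hu => ih _ (h ▸ hu) u rfl), hT, mul_one] at h1

/-- The difference of two candidates for `U₋` is polar even at the empty word, where the two values
`1` cancel, and its product with `T` is regular. -/
theorem IsBirkhoffDecomposition.unique (hT : T [] = 1) {Um Up : List α → LaurentSeries ℂ}
    (h : IsBirkhoffDecomposition T Um Up) : Um = birkhoffMinus T ∧ Up = birkhoffPlus T := by
  have hmul : convol Um T = Up := h.mul_eq
  have h1 : Um - birkhoffMinus T = 0 := by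
    refine eq_zero_of_convol_regular hT _ (fun w => ?_) (fun w => ?_)
    · by_cases hw : w = []
      · rw [hw, Pi.sub_apply, h.minus_nil, birkhoffMinus_nil, sub_self]
        exact zero_mem _
      · exact sub_mem (h.minus_polar w hw) (birkhoffMinus_mem w hw)
    · rw [convol_sub_left, hmul, birkhoff_convol hT]
      exact sub_mem (h.plus_regular w) (birkhoffPlus_mem w)
  have h2 := sub_eq_zero.1 h1
  exact ⟨h2, by rw [← hmul, h2, birkhoff_convol hT]⟩

/-- The defect of symmetrality of `U₋` is polar. Multiplied by `T ⊗ T`, it becomes the defect of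
symmetrality of `U₊`, which is regular. By induction on the total length the product reduces to the
defect itself, which is therefore both polar and regular. -/
theorem isSymmetral_birkhoffMinus (hT : T [] = 1) (hs : IsSymmetral T) :
    IsSymmetral (birkhoffMinus T) := by
  have hsT : shuffleSum T = tensor T T := by funext u v; exact hs u v
  intro u v
  rw [← sub_eq_zero]
  induction h : u.length + v.length using Nat.strong_induction_on generalizing u v with
  | _ n ih =>
  by_cases huv : u ++ v = []
  · obtain ⟨rfl, rfl⟩ := List.append_eq_nil_iff.1 huv
    simp [shuffleSum, birkhoffMinus_nil]
  have hlen : u.length + v.length ≠ 0 := by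
    rwa [← List.length_append, Ne, List.length_eq_zero_iff]
  refine eq_zero_of_polar_of_regular (sub_mem (shuffleSum_mem _ _ _ _ fun w hw => ?_) ?_) ?_
  · refine birkhoffMinus_mem w ?_
    rintro rfl
    exact hlen hw.symm
  · by_cases hu : u = []
    · subst hu
      rw [birkhoffMinus_nil, one_mul]
      exact birkhoffMinus_mem v (by simpa using huv)
    by_cases hv : v = []
    · subst hv
      rw [birkhoffMinus_nil, mul_one]
      exact birkhoffMinus_mem u hu
    exact fun n hn => coeff_mul_of_polar (birkhoffMinus_mem u hu) (birkhoffMinus_mem v hv) n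
      (by omega)
  · have h2 := diConvol_eq_of_shorter
      (shuffleSum (birkhoffMinus T) - tensor (birkhoffMinus T) (birkhoffMinus T)) (shuffleSum T) u v
      (fun u' v' hlt => ih _ (h ▸ hlt) u' v' rfl)
    rw [shuffleSum_nil_left, hT, mul_one] at h2
    change (shuffleSum (birkhoffMinus T) - tensor (birkhoffMinus T) (birkhoffMinus T)) u v ∈ _
    rw [← h2, diConvol_sub_left, Pi.sub_apply, Pi.sub_apply, ← shuffleSum_convol, hsT,
      diConvol_tensor, birkhoff_convol hT]
    exact sub_mem (shuffleSum_mem regularSubring.toAddSubgroup _ _ _ fun w _ => birkhoffPlus_mem w)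
      (mul_mem (birkhoffPlus_mem u) (birkhoffPlus_mem v))

/-- Products of symmetral moulds are symmetral. -/
theorem isSymmetral_birkhoffPlus (hT : T [] = 1) (hs : IsSymmetral T) :
    IsSymmetral (birkhoffPlus T) := by
  have hsT : shuffleSum T = tensor T T := by funext u v; exact hs u v
  have hsU : shuffleSum (birkhoffMinus T) = tensor (birkhoffMinus T) (birkhoffMinus T) := by
    funext u v; exact isSymmetral_birkhoffMinus hT hs u v
  intro u v
  rw [← birkhoff_convol hT, shuffleSum_convol, hsT, hsU, diConvol_tensor]

end Birkhoff

/-! ### The mould equation linking `S` and `N`; resonance -/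

section Normalization

variable {α : Type*} (φ : α → ℂ)

/-- The additive map extracting a coefficient of a Laurent series. -/
def laurentCoeff (n : ℤ) : LaurentSeries ℂ →+ ℂ where
  toFun x := x.coeff n
  map_zero' := HahnSeries.coeff_zero
  map_add' x y := by simp

theorem mouldS_nil : mouldS φ [] = 1 := by
  rw [mouldS, birkhoffPlus_nil]
  simp

theorem isSymmetral_mouldS : IsSymmetral (mouldS φ) := by
  intro u v
  have h := shuffleSum_map (laurentCoeff 0) (birkhoffPlus (mouldT φ)) u v
  rw [isSymmetral_birkhoffPlus (mouldT_nil φ) (isSymmetral_mouldT φ) u v] at h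
  exact h.trans (coeff_zero_mul_of_regular (birkhoffPlus_mem u) (birkhoffPlus_mem v))

/-- A product of two series in `ε⁻¹ℂ[ε⁻¹]` starts at `ε⁻²` or lower, so the residue kills the
products given by symmetrality of `U₋`. -/
theorem isAlternal_mouldN : IsAlternal (mouldN φ) := by
  refine ⟨?_, fun u v hu hv => ?_⟩
  · rw [mouldN, birkhoffMinus_nil]
    simp [HahnSeries.coeff_one]
  · have h := shuffleSum_map (-laurentCoeff (-1)) (birkhoffMinus (mouldT φ)) u v
    rw [isSymmetral_birkhoffMinus (mouldT_nil φ) (isSymmetral_mouldT φ) u v] at h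
    refine h.trans ?_
    rw [AddMonoidHom.neg_apply, neg_eq_zero]
    exact coeff_mul_of_polar (birkhoffMinus_mem u hu) (birkhoffMinus_mem v hv) _ le_rfl

/-- The mould `r N`, with `r` the length of the word. -/
noncomputable def lengthN (w : List α) : ℂ := w.length * mouldN φ w

/-- The mould `r N` with values in the constant Laurent series. -/
noncomputable def laurentN (w : List α) : LaurentSeries ℂ := HahnSeries.C (lengthN φ w)

theorem laurentN_mem (w : List α) : laurentN φ w ∈ regularSubring := fun n hn => by
  rw [laurentN, coeff_laurentC, if_neg hn.ne]

theorem coeff_laurentN_mul (w : List α) (x : LaurentSeries ℂ) (n : ℤ) :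
    (laurentN φ w * x).coeff n = lengthN φ w * x.coeff n := by
  rw [laurentN, HahnSeries.C_mul_eq_smul, HahnSeries.coeff_smul, smul_eq_mul]

/-- The left side is polar: the only constant term of `∇U₋` is `r` times the residue of `U₋`, and
`rN` cancels it. Its product with `T` is regular, because `∇U₋ × T = ∇U₊ - U₊ × I`. So it vanishes.
-/
theorem convol_laurentN_birkhoffMinus :
    convol (laurentN φ) (birkhoffMinus (mouldT φ)) +
      nabla (laurentWeight φ) (birkhoffMinus (mouldT φ)) = 0 := by
  refine eq_zero_of_convol_regular (T := mouldT φ) (mouldT_nil φ) _ (fun w => ?_) (fun w => ?_)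
  · by_cases hw : w = []
    · subst hw
      simp [convol_nil, nabla, laurentN, lengthN]
    rw [Pi.add_apply, convol, sum_range_succ, List.take_length, List.drop_length,
      birkhoffMinus_nil, mul_one, add_assoc]
    refine add_mem (sum_mem fun i hi => ?_) ?_
    · intro n hn
      rw [mem_range] at hi
      rw [coeff_laurentN_mul, birkhoffMinus_mem _ (by simpa using hi) n hn, mul_zero]
    · intro n hn
      rw [HahnSeries.coeff_add, nabla, coeff_laurentWeight_sum_mul, birkhoffMinus_mem w hw n hn,
        laurentN, coeff_laurentC]
      split_ifs with h0
      · subst h0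
        rw [lengthN, mouldN]
        simp
      · rw [birkhoffMinus_mem w hw _ (by omega)]
        simp
  · have h : convol (convol (laurentN φ) (birkhoffMinus (mouldT φ)) +
        nabla (laurentWeight φ) (birkhoffMinus (mouldT φ))) (mouldT φ) =
        convol (laurentN φ) (birkhoffPlus (mouldT φ)) +
          (nabla (laurentWeight φ) (birkhoffPlus (mouldT φ)) -
            convol (birkhoffPlus (mouldT φ)) mouldI) := by
      rw [← birkhoff_convol (mouldT_nil φ), nabla_convol, nabla_mouldT, convol_add_left,
        convol_assoc, convol_assoc]
      abel
    rw [h]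
    have hI : ∀ u : List α, (mouldI u : LaurentSeries ℂ) ∈ regularSubring := fun u => by
      rw [mouldI]; split_ifs
      exacts [one_mem _, zero_mem _]
    refine add_mem (sum_mem fun i _ => mul_mem (laurentN_mem φ _) (birkhoffPlus_mem _))
      (sub_mem (fun n hn => ?_) (sum_mem fun i _ => mul_mem (birkhoffPlus_mem _) (hI _)))
    rw [nabla, coeff_laurentWeight_sum_mul, birkhoffPlus_mem w n hn,
      birkhoffPlus_mem w (n - 1) (by omega), mul_zero, mul_zero, add_zero]

/-- The polar factor and the normal form are supported on resonant words. -/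
theorem resonant (w : List α) (hw : (w.map φ).sum ≠ 0) :
    birkhoffMinus (mouldT φ) w = 0 ∧ lengthN φ w = 0 := by
  induction h : w.length using Nat.strong_induction_on generalizing w with
  | _ n ih =>
  have hne : w ≠ [] := by
    rintro rfl
    exact hw rfl
  have h1 := congrFun (convol_laurentN_birkhoffMinus φ) w
  have h2 : convol (laurentN φ) (birkhoffMinus (mouldT φ)) w = laurentN φ w := by
    rw [convol, sum_range_succ, List.take_length, List.drop_length, birkhoffMinus_nil, mul_one,
      sum_eq_zero, zero_add]
    intro i hi
    rw [mem_range] at hi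
    by_cases hi0 : i = 0
    · subst hi0
      simp [laurentN, lengthN]
    -- The prefix and the suffix cannot both have weight zero, so the induction hypothesis kills
    -- every proper splitting.
    by_cases h3 : ((w.take i).map φ).sum = 0
    · have h4 : ((w.drop i).map φ).sum ≠ 0 := by
        intro h4
        apply hw
        rw [← List.take_append_drop i w, List.map_append, List.sum_append, h3, h4, add_zero]
      rw [(ih (w.drop i).length (by rw [List.length_drop]; omega) _ h4 rfl).1, mul_zero]
    · rw [laurentN, (ih (w.take i).length (by rw [List.length_take]; omega) _ h3 rfl).2, map_zero,
        zero_mul]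
  rw [Pi.add_apply, h2, nabla, Pi.zero_apply] at h1
  -- What remains is `rN + (Σφ + rε) U₋ = 0`. At a negative exponent `n` it reads `Σφ · cₙ + r cₙ₋₁
  -- = 0`, so vanishing propagates upwards from the order of the series.
  have h5 : ∀ m : ℕ, ∀ n : ℤ, n < 0 →
      (birkhoffMinus (mouldT φ) w).order + m = n → (birkhoffMinus (mouldT φ) w).coeff n = 0 := by
    intro m
    induction m with
    | zero =>
      intro n hn hmn
      have h6 := congrArg (fun x => x.coeff n) h1
      simp only [HahnSeries.coeff_add, coeff_laurentWeight_sum_mul, laurentN, coeff_laurentC,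
        if_neg hn.ne, HahnSeries.coeff_zero, zero_add] at h6
      rw [HahnSeries.coeff_eq_zero_of_lt_order (i := n - 1) (by push_cast at hmn; omega), mul_zero,
        add_zero] at h6
      exact (mul_eq_zero.1 h6).resolve_left hw
    | succ m ihm =>
      intro n hn hmn
      have h6 := congrArg (fun x => x.coeff n) h1
      simp only [HahnSeries.coeff_add, coeff_laurentWeight_sum_mul, laurentN, coeff_laurentC,
        if_neg hn.ne, HahnSeries.coeff_zero, zero_add] at h6
      rw [ihm (n - 1) (by omega) (by push_cast at hmn; omega), mul_zero, add_zero] at h6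
      exact (mul_eq_zero.1 h6).resolve_left hw
  have h7 : birkhoffMinus (mouldT φ) w = 0 := by
    ext n
    rw [HahnSeries.coeff_zero]
    rcases lt_or_ge n 0 with hn | hn
    · rcases lt_or_ge n (birkhoffMinus (mouldT φ) w).order with ho | ho
      · exact HahnSeries.coeff_eq_zero_of_lt_order ho
      · exact h5 (n - (birkhoffMinus (mouldT φ) w).order).toNat n hn (by omega)
    · exact birkhoffMinus_mem w hne n hn
  refine ⟨h7, ?_⟩
  rw [lengthN, mouldN, h7]
  simp

theorem nabla_lengthN : nabla φ (lengthN φ) = 0 := by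
  funext w
  rw [nabla, Pi.zero_apply, mul_eq_zero]
  exact or_iff_not_imp_left.2 fun h => (resonant φ w h).2

/-- The identity for `U₋` multiplied on the right by `T`. -/
theorem convol_laurentN_birkhoffPlus :
    convol (laurentN φ) (birkhoffPlus (mouldT φ)) +
      nabla (laurentWeight φ) (birkhoffPlus (mouldT φ)) =
      convol (birkhoffPlus (mouldT φ)) mouldI := by
  have h := congrArg (fun D => convol D (mouldT φ)) (convol_laurentN_birkhoffMinus φ)
  simp only [convol_add_left, convol_assoc, birkhoff_convol (mouldT_nil φ)] at h
  have h0 : convol (0 : List α → LaurentSeries ℂ) (mouldT φ) = 0 := by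
    funext w
    simp [convol]
  rw [h0] at h
  conv_lhs => enter [2]; rw [← birkhoff_convol (mouldT_nil φ), nabla_convol, nabla_mouldT]
  rw [← convol_assoc, birkhoff_convol (mouldT_nil φ), ← add_assoc, h, zero_add]

/-- The mould equation `∇ S = S × I - (r N) × S`. -/
theorem nabla_mouldS :
    nabla φ (mouldS φ) = convol (mouldS φ) mouldI - convol (lengthN φ) (mouldS φ) := by
  funext w
  have h := congrArg (laurentCoeff 0) (congrFun (convol_laurentN_birkhoffPlus φ) w)
  rw [Pi.add_apply, map_add, convol, convol, map_sum, map_sum, nabla] at h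
  -- The `rε` part of the weight does not contribute, because `U₊` has no residue.
  have h1 : laurentCoeff 0 ((w.map (laurentWeight φ)).sum * birkhoffPlus (mouldT φ) w) =
      (w.map φ).sum * mouldS φ w := by
    refine (coeff_laurentWeight_sum_mul φ w _ 0).trans ?_
    rw [birkhoffPlus_mem w (0 - 1) (by norm_num), mul_zero, add_zero, mouldS]
  have h2 : ∀ i, laurentCoeff 0 (laurentN φ (w.take i) * birkhoffPlus (mouldT φ) (w.drop i)) =
      lengthN φ (w.take i) * mouldS φ (w.drop i) := fun i =>
    coeff_laurentN_mul φ _ _ 0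
  have h3 : ∀ i, laurentCoeff 0 (birkhoffPlus (mouldT φ) (w.take i) * mouldI (w.drop i)) =
      mouldS φ (w.take i) * mouldI (w.drop i) := fun i => by
    rw [mouldI, mouldI, mouldS]
    split_ifs
    · rw [mul_one, mul_one]; rfl
    · rw [mul_zero, mul_zero, map_zero]
  simp only [h1, h2, h3] at h
  rw [nabla, Pi.sub_apply, convol, convol, ← h]
  ring

end Normalization

/-! ### Complex conjugation of the moulds -/

section Conjugation

variable {α β : Type*}

/-- Coefficientwise complex conjugation of Laurent series. -/
noncomputable def laurentConj : LaurentSeries ℂ →+* LaurentSeries ℂ where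
  toFun x := x.map (starRingEnd ℂ)
  map_zero' := by ext; simp
  map_one' := HahnSeries.map_one (starRingEnd ℂ).toMonoidWithZeroHom
  map_add' _ _ := HahnSeries.map_add (starRingEnd ℂ).toAddMonoidHom
  map_mul' x y := by
    have h := HahnSeries.map_mul ((starRingEnd ℂ : ℂ →+* ℂ) : ℂ →ₙ+* ℂ) (x := x) (y := y)
    ext n
    exact congrArg (fun z => z.coeff n) h

theorem coeff_laurentConj (x : LaurentSeries ℂ) (n : ℤ) :
    (laurentConj x).coeff n = starRingEnd ℂ (x.coeff n) := rfl

theorem mouldT_map_conj (φ : α → ℂ) (ψ : β → ℂ) (f : α → β)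
    (hf : ∀ x, ψ (f x) = starRingEnd ℂ (φ x)) (w : List α) :
    mouldT ψ (w.map f) = laurentConj (mouldT φ w) := by
  have hc : ∀ c : ℂ, laurentConj (HahnSeries.C c) = HahnSeries.C (starRingEnd ℂ c) := fun c =>
    HahnSeries.map_C c _
  have he : laurentConj (HahnSeries.single (1 : ℤ) 1) = HahnSeries.single (1 : ℤ) 1 := by
    ext n
    rw [coeff_laurentConj, HahnSeries.coeff_single]
    split_ifs <;> simp
  rw [mouldT, mouldT, List.length_map, map_prod]
  refine prod_congr rfl fun j _ => ?_
  rw [map_inv₀, map_add, map_mul, map_add, map_natCast, map_one laurentConj, he, hc, map_list_sum (starRingEnd ℂ),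
    ← List.map_take, List.map_map, List.map_map]
  simp only [Function.comp_def, hf]

/-- Conjugating the letters conjugates the Birkhoff decomposition. -/
theorem mouldS_map_conj (φ : α → ℂ) (ψ : α → ℂ) (f : α → α) (hinv : ∀ x, f (f x) = x)
    (hf : ∀ x, ψ (f x) = starRingEnd ℂ (φ x)) (w : List α) :
    mouldS ψ (w.map f) = starRingEnd ℂ (mouldS φ w) := by
  have hff : ∀ w : List α, (w.map f).map f = w := fun w => by
    rw [List.map_map, show f ∘ f = id from funext hinv, List.map_id]
  -- Conjugating coefficients preserves polarity, regularity and products, so uniqueness identifies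
  -- the conjugated pair with the decomposition for `ψ`.
  have hdec : IsBirkhoffDecomposition (mouldT ψ)
      (fun w => laurentConj (birkhoffMinus (mouldT φ) (w.map f)))
      (fun w => laurentConj (birkhoffPlus (mouldT φ) (w.map f))) := by
    refine ⟨by simp [birkhoffMinus_nil], by simp [birkhoffPlus_nil], fun w hw n hn => ?_,
      fun w n hn => ?_, ?_⟩
    · rw [coeff_laurentConj, birkhoffMinus_mem _ (by simpa using hw) n hn, map_zero]
    · rw [coeff_laurentConj, birkhoffPlus_mem _ n hn, map_zero]
    · funext w
      rw [← birkhoff_convol (mouldT_nil φ), convol, map_sum, List.length_map]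
      refine sum_congr rfl fun i _ => ?_
      rw [map_mul, ← mouldT_map_conj φ ψ f hf, ← List.map_drop, hff, ← List.map_take]
  have h := congrFun (hdec.unique (mouldT_nil ψ)).2 (w.map f)
  rw [mouldS, ← h]
  simp only [hff, coeff_laurentConj]
  rfl

end Conjugation

/-! ### Words of fixed length on finitely many letters -/

section Words

variable {α : Type*}

/-- The words of a given length on a finite set of letters. -/
def words (F : Finset α) : ℕ → Finset (List α)
  | 0 => {[]}
  | r + 1 => (F ×ˢ words F r).map
      ⟨fun p => p.1 :: p.2, fun p q h => by
        simp only [List.cons.injEq] at h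
        exact Prod.ext h.1 h.2⟩

theorem sum_words_succ {M : Type*} [AddCommMonoid M] (F : Finset α) (r : ℕ) (f : List α → M) :
    ∑ w ∈ words F (r + 1), f w = ∑ x ∈ F, ∑ w ∈ words F r, f (x :: w) := by
  rw [words, sum_map, sum_product]
  rfl

theorem mem_words {F : Finset α} {r : ℕ} {w : List α} :
    w ∈ words F r ↔ w.length = r ∧ ∀ x ∈ w, x ∈ F := by
  induction r generalizing w with
  | zero =>
    rw [words, mem_singleton, List.length_eq_zero_iff]
    constructor
    · rintro rfl; simp
    · exact fun h => h.1
  | succ r ih =>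
    simp only [words, mem_map, mem_product, Prod.exists]
    constructor
    · rintro ⟨x, u, ⟨hx, hu⟩, rfl⟩
      rw [ih] at hu
      change (x :: u).length = r + 1 ∧ ∀ y ∈ x :: u, y ∈ F
      simpa [hu.1, hx] using hu.2
    · rintro ⟨h1, h2⟩
      rcases w with _ | ⟨x, u⟩
      · simp at h1
      · refine ⟨x, u, ⟨h2 x (by simp), ih.2 ⟨by simpa using h1, fun y hy => h2 y (by simp [hy])⟩⟩,
          rfl⟩

theorem sum_words_reverse {M : Type*} [AddCommMonoid M] (F : Finset α) (r : ℕ)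
    (f : List α → M) : ∑ w ∈ words F r, f w.reverse = ∑ w ∈ words F r, f w :=
  sum_nbij' List.reverse List.reverse (by simp [mem_words]) (by simp [mem_words]) (by simp)
    (by simp) (by simp)

theorem sum_words_map {M : Type*} [AddCommMonoid M] [DecidableEq α] (F : Finset α) (r : ℕ)
    (g : α → α) (hg : ∀ x, g (g x) = x) (f : List α → M) :
    ∑ w ∈ words F r, f (w.map g) = ∑ w ∈ words (F.image g) r, f w := by
  have hgg : g ∘ g = id := funext hg
  refine sum_nbij' (List.map g) (List.map g) ?_ ?_ (by simp [hgg]) (by simp [hgg]) (by simp)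
  · intro w
    simp only [mem_words, List.length_map, List.mem_map, forall_exists_index, and_imp,
      forall_apply_eq_imp_iff₂]
    exact fun h1 h2 => ⟨h1, fun x hx => mem_image_of_mem g (h2 x hx)⟩
  · intro w
    simp only [mem_words, List.length_map, List.mem_map, forall_exists_index, and_imp,
      forall_apply_eq_imp_iff₂]
    refine fun h1 h2 => ⟨h1, fun x hx => ?_⟩
    obtain ⟨y, hy, rfl⟩ := mem_image.1 (h2 x hx)
    rwa [hg]

end Words

/-! ### Expansions of moulds over noncommuting letters -/

section WordSum

variable {α 𝔼 : Type*} [Ring 𝔼] [Algebra ℂ 𝔼]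

/-- The contribution of the words of length `r` on `F` to the expansion attached to a mould. -/
def wordSum (b : α → 𝔼) (F : Finset α) (r : ℕ) (M : List α → ℂ) : 𝔼 :=
  ∑ w ∈ words F r, M w • (w.map b).prod

theorem wordSum_zero (b : α → 𝔼) (F : Finset α) (M : List α → ℂ) :
    wordSum b F 0 M = M [] • (1 : 𝔼) := by
  simp [wordSum, words]

theorem wordSum_succ (b : α → 𝔼) (F : Finset α) (r : ℕ) (M : List α → ℂ) :
    wordSum b F (r + 1) M = ∑ x ∈ F, b x * wordSum b F r (lder x M) := by
  rw [wordSum, sum_words_succ]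
  refine sum_congr rfl fun x _ => ?_
  rw [wordSum, mul_sum]
  refine sum_congr rfl fun w _ => ?_
  rw [List.map_cons, List.prod_cons, mul_smul_comm, lder]

theorem wordSum_add (b : α → 𝔼) (F : Finset α) (r : ℕ) (M N : List α → ℂ) :
    wordSum b F r (M + N) = wordSum b F r M + wordSum b F r N := by
  simp [wordSum, add_smul, sum_add_distrib]

theorem wordSum_sub (b : α → 𝔼) (F : Finset α) (r : ℕ) (M N : List α → ℂ) :
    wordSum b F r (M - N) = wordSum b F r M - wordSum b F r N := by
  simp [wordSum, sub_smul, sum_sub_distrib]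

theorem wordSum_mul_left (b : α → 𝔼) (F : Finset α) (r : ℕ) (c : ℂ) (M : List α → ℂ) :
    wordSum b F r (fun w => c * M w) = c • wordSum b F r M := by
  simp [wordSum, mul_smul, smul_sum]

/-- Each word of length `n` is uniquely a word of length `i` followed by one of length `n - i`. The
induction peels off the first letter by `lder_convol`. -/
theorem wordSum_convol (b : α → 𝔼) (F : Finset α) (n : ℕ) (M N : List α → ℂ) :
    wordSum b F n (convol M N) =
      ∑ p ∈ antidiagonal n, wordSum b F p.1 M * wordSum b F p.2 N := by
  induction n generalizing M with
  | zero => simp [wordSum_zero, convol_nil, smul_smul, mul_comm]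
  | succ n ih =>
    rw [Nat.sum_antidiagonal_succ, wordSum_succ, wordSum_zero, smul_one_mul]
    simp only [lder_convol, wordSum_add, wordSum_mul_left, ih, mul_add, sum_add_distrib]
    rw [add_comm]
    congr 1
    · simp only [mul_smul_comm, ← smul_sum, ← wordSum_succ]
    · simp only [mul_sum]
      rw [sum_comm]
      refine sum_congr rfl fun p _ => ?_
      rw [wordSum_succ, sum_mul]
      simp only [mul_assoc]

theorem wordSum_mouldI (b : α → 𝔼) (F : Finset α) (n : ℕ) :
    wordSum b F n mouldI = if n = 1 then ∑ x ∈ F, b x else 0 := by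
  split_ifs with h
  · subst h
    rw [wordSum_succ]
    refine sum_congr rfl fun x _ => ?_
    rw [wordSum_zero]
    simp [lder, mouldI]
  · refine sum_eq_zero fun w hw => ?_
    rw [mouldI, if_neg (by rw [(mem_words.1 hw).1]; exact h), zero_smul]

theorem wordSum_mouldOne (b : α → 𝔼) (F : Finset α) (n : ℕ) :
    wordSum b F n mouldOne = if n = 0 then 1 else 0 := by
  split_ifs with h
  · subst h
    rw [wordSum_zero]
    simp [mouldOne]
  · refine sum_eq_zero fun w hw => ?_
    rw [mouldOne, if_neg (by rw [(mem_words.1 hw).1]; exact h), zero_smul]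

/-- The two-sided expansion attached to a dimould. -/
def biWordSum (ℓ ρ : α → 𝔼) (F : Finset α) (i j : ℕ) (G : List α → List α → ℂ) : 𝔼 :=
  ∑ u ∈ words F i, ∑ v ∈ words F j, G u v • ((u.map ℓ).prod * (v.map ρ).prod)

theorem biWordSum_add (ℓ ρ : α → 𝔼) (F : Finset α) (i j : ℕ) (G K : List α → List α → ℂ) :
    biWordSum ℓ ρ F i j (G + K) = biWordSum ℓ ρ F i j G + biWordSum ℓ ρ F i j K := by
  simp [biWordSum, add_smul, sum_add_distrib]

theorem biWordSum_tensor (ℓ ρ : α → 𝔼) (F : Finset α) (i j : ℕ) (M N : List α → ℂ) :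
    biWordSum ℓ ρ F i j (tensor M N) = wordSum ℓ F i M * wordSum ρ F j N := by
  rw [wordSum, wordSum, sum_mul_sum, biWordSum]
  refine sum_congr rfl fun u _ => sum_congr rfl fun v _ => ?_
  rw [smul_mul_smul_comm, tensor]

theorem biWordSum_diUnit (ℓ ρ : α → 𝔼) (F : Finset α) (i j : ℕ) (h : i + j ≠ 0) (c : ℂ) :
    biWordSum ℓ ρ F i j (diUnit c) = 0 := by
  refine sum_eq_zero fun u hu => sum_eq_zero fun v hv => ?_
  have h1 := (mem_words.1 hu).1
  have h2 := (mem_words.1 hv).1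
  rcases u with _ | ⟨x, u⟩ <;> rcases v with _ | ⟨y, v⟩ <;> simp [diUnit]
  simp only [List.length_nil] at h1 h2
  omega

theorem biWordSum_onLeft_zero (ℓ ρ : α → 𝔼) (F : Finset α) (j : ℕ)
    (G : α → List α → List α → ℂ) : biWordSum ℓ ρ F 0 j (onLeft G) = 0 := by
  simp [biWordSum, words, onLeft]

theorem biWordSum_onRight_zero (ℓ ρ : α → 𝔼) (F : Finset α) (i : ℕ)
    (G : α → List α → List α → ℂ) : biWordSum ℓ ρ F i 0 (onRight G) = 0 := by
  simp [biWordSum, words, onRight]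

theorem biWordSum_onLeft_succ (ℓ ρ : α → 𝔼) (F : Finset α) (i j : ℕ)
    (G : α → List α → List α → ℂ) :
    biWordSum ℓ ρ F (i + 1) j (onLeft G) = ∑ x ∈ F, ℓ x * biWordSum ℓ ρ F i j (G x) := by
  rw [biWordSum, sum_words_succ]
  refine sum_congr rfl fun x _ => ?_
  rw [biWordSum, mul_sum]
  refine sum_congr rfl fun u _ => ?_
  rw [mul_sum]
  refine sum_congr rfl fun v _ => ?_
  rw [List.map_cons, List.prod_cons, mul_smul_comm, onLeft, mul_assoc]

theorem biWordSum_onRight_succ (ℓ ρ : α → 𝔼) (hc : ∀ x y, Commute (ℓ x) (ρ y)) (F : Finset α)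
    (i j : ℕ) (G : α → List α → List α → ℂ) :
    biWordSum ℓ ρ F i (j + 1) (onRight G) = ∑ y ∈ F, ρ y * biWordSum ℓ ρ F i j (G y) := by
  simp only [biWordSum, sum_words_succ, mul_sum]
  rw [sum_comm]
  refine sum_congr rfl fun y _ => sum_congr rfl fun u _ => sum_congr rfl fun v _ => ?_
  have h : Commute (u.map ℓ).prod (ρ y) := by
    refine Commute.list_prod_left _ _ fun z hz => ?_
    obtain ⟨x, -, rfl⟩ := List.mem_map.1 hz
    exact hc x y
  rw [List.map_cons, List.prod_cons, mul_smul_comm, ← mul_assoc, h.eq, mul_assoc]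
  rcases u with _ | ⟨x, u⟩ <;> rfl

/-- The expansion in sums of commuting letters is the two-sided expansion of the shuffle sums. -/
theorem wordSum_add_letters (ℓ ρ : α → 𝔼) (hc : ∀ x y, Commute (ℓ x) (ρ y)) (F : Finset α)
    (n : ℕ) (M : List α → ℂ) :
    wordSum (fun x => ℓ x + ρ x) F n M =
      ∑ p ∈ antidiagonal n, biWordSum ℓ ρ F p.1 p.2 (shuffleSum M) := by
  induction n generalizing M with
  | zero => simp [wordSum_zero, biWordSum, words, shuffleSum]
  | succ n ih =>
    rw [wordSum_succ, shuffleSum_eq]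
    simp only [biWordSum_add, sum_add_distrib]
    rw [sum_eq_zero (f := fun p : ℕ × ℕ => biWordSum ℓ ρ F p.1 p.2 (diUnit (M []))), zero_add,
      Nat.sum_antidiagonal_succ, Nat.sum_antidiagonal_succ', biWordSum_onLeft_zero,
      biWordSum_onRight_zero, zero_add, zero_add]
    · simp only [biWordSum_onLeft_succ, biWordSum_onRight_succ ℓ ρ hc, ih, add_mul, mul_sum,
        sum_add_distrib]
      rw [sum_comm, add_right_inj, sum_comm]
    · intro p hp
      rw [HasAntidiagonal.mem_antidiagonal] at hp
      exact biWordSum_diUnit _ _ _ _ _ (by omega) _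

/-- Symmetral moulds have group-like expansions, which behave like exponentials on commuting
summands. -/
theorem IsSymmetral.wordSum_add_letters {M : List α → ℂ} (hM : IsSymmetral M) (ℓ ρ : α → 𝔼)
    (hc : ∀ x y, Commute (ℓ x) (ρ y)) (F : Finset α) (n : ℕ) :
    wordSum (fun x => ℓ x + ρ x) F n M =
      ∑ p ∈ antidiagonal n, wordSum ℓ F p.1 M * wordSum ρ F p.2 M := by
  rw [BirkhoffRS.wordSum_add_letters ℓ ρ hc, show shuffleSum M = tensor M M from
    funext fun u => funext fun v => hM u v]
  simp only [biWordSum_tensor]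

theorem IsAlternal.shuffleSum_eq {M : List α → ℂ} (hM : IsAlternal M) :
    shuffleSum M = tensor M mouldOne + tensor mouldOne M := by
  funext u v
  rcases u with _ | ⟨x, u⟩
  · rw [shuffleSum_nil_left]; simp [tensor, mouldOne, hM.1]
  rcases v with _ | ⟨y, v⟩
  · rw [shuffleSum_nil_right]; simp [tensor, mouldOne, hM.1]
  · rw [hM.2 _ _ (by simp) (by simp)]
    simp [tensor, mouldOne]

/-- Alternal moulds have primitive expansions, which are additive on commuting summands. -/
theorem IsAlternal.wordSum_add_letters {M : List α → ℂ} (hM : IsAlternal M) (ℓ ρ : α → 𝔼)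
    (hc : ∀ x y, Commute (ℓ x) (ρ y)) (F : Finset α) (n : ℕ) :
    wordSum (fun x => ℓ x + ρ x) F n M = wordSum ℓ F n M + wordSum ρ F n M := by
  rw [BirkhoffRS.wordSum_add_letters ℓ ρ hc, hM.shuffleSum_eq]
  simp only [biWordSum_add, biWordSum_tensor, sum_add_distrib, wordSum_mouldOne, mul_ite, mul_one,
    mul_zero, ite_mul, one_mul, zero_mul]
  congr 1
  · rw [sum_eq_single (n, 0)]
    · simp
    · rintro ⟨i, j⟩ h hne
      rw [HasAntidiagonal.mem_antidiagonal] at h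
      refine if_neg fun h0 => hne ?_
      simp only at h h0
      rw [h0] at h ⊢
      rw [← h, add_zero]
    · simp
  · rw [sum_eq_single (0, n)]
    · simp
    · rintro ⟨i, j⟩ h hne
      rw [HasAntidiagonal.mem_antidiagonal] at h
      refine if_neg fun h0 => hne ?_
      simp only at h h0
      rw [h0] at h ⊢
      rw [← h, zero_add]
    · simp

end WordSum

/-! ### Commutator expansions: conjugation and the Dynkin identity -/

section Adjoint

variable {α 𝔸 : Type*} [Ring 𝔸] [Algebra ℂ 𝔸]

/-- The image of a mould under the antipode. -/
def antipode (M : List α → ℂ) (w : List α) : ℂ := (-1) ^ w.length * M w.reverse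

theorem wordSum_antipode (b : α → 𝔸) (F : Finset α) (n : ℕ) (M : List α → ℂ) :
    wordSum b F n (antipode M) =
      ∑ w ∈ words F n, ((-1) ^ n * M w) • (w.reverse.map b).prod := by
  rw [wordSum, ← sum_words_reverse]
  refine sum_congr rfl fun w hw => ?_
  rw [antipode, List.length_reverse, List.reverse_reverse, (mem_words.1 hw).1]

/-- The iterated commutator `[b₁, [b₂, … [b_r, A] … ]]`. -/
def iterComm (b : α → 𝔸) (w : List α) (A : 𝔸) : 𝔸 :=
  w.foldr (fun x Y => b x * Y - Y * b x) A

/-- The right-nested commutator `[b₁, [b₂, … [b_{r-1}, b_r] … ]]`. -/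
def nestedComm (b : α → 𝔸) : List α → 𝔸
  | [] => 0
  | [x] => b x
  | x :: y :: w => b x * nestedComm b (y :: w) - nestedComm b (y :: w) * b x

/-- The adjoint action of the expansion of a symmetral mould is a conjugation. -/
theorem IsSymmetral.sum_iterComm {M : List α → ℂ} (hM : IsSymmetral M) (b : α → 𝔸)
    (F : Finset α) (n : ℕ) (A : 𝔸) :
    ∑ w ∈ words F n, M w • iterComm b w A =
      ∑ p ∈ antidiagonal n, wordSum b F p.1 M * (A * wordSum b F p.2 (antipode M)) := by
  -- The commutator with `b x` is a left multiplication minus a right one, and these commute by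
  -- associativity. Composing right multiplications reverses words, hence the antipode.
  let ℓ : α → Module.End ℂ 𝔸 := fun x => LinearMap.mulLeft ℂ (b x)
  let ρ : α → Module.End ℂ 𝔸 := fun x => -LinearMap.mulRight ℂ (b x)
  have hc : ∀ x y, Commute (ℓ x) (ρ y) := fun x y => by
    refine LinearMap.ext fun a => ?_
    simp [ℓ, ρ, mul_assoc]
  have hℓ : ∀ (w : List α) (a : 𝔸), (w.map ℓ).prod a = (w.map b).prod * a := fun w a => by
    induction w with
    | nil => simp
    | cons x w ih => simp [ih, ℓ, mul_assoc]
  have hρ : ∀ (w : List α) (a : 𝔸),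
      (w.map ρ).prod a = ((-1 : ℂ) ^ w.length) • (a * (w.reverse.map b).prod) := fun w a => by
    induction w with
    | nil => simp
    | cons x w ih => simp [ih, ρ, pow_succ, mul_assoc]
  have had : ∀ w : List α, (w.map fun x => ℓ x + ρ x).prod A = iterComm b w A := fun w => by
    induction w with
    | nil => simp [iterComm]
    | cons x w ih =>
      rw [List.map_cons, List.prod_cons, Module.End.mul_apply, ih]
      simp [ℓ, ρ, iterComm, sub_eq_add_neg]
  have h := LinearMap.congr_fun (hM.wordSum_add_letters ℓ ρ hc F n) A
  rw [wordSum, LinearMap.sum_apply, LinearMap.sum_apply] at h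
  simp only [LinearMap.smul_apply, had] at h
  rw [h]
  refine sum_congr rfl fun p _ => ?_
  rw [Module.End.mul_apply]
  have h1 : wordSum ρ F p.2 M A = A * wordSum b F p.2 (antipode M) := by
    rw [wordSum_antipode, wordSum, LinearMap.sum_apply, mul_sum]
    refine sum_congr rfl fun w hw => ?_
    rw [LinearMap.smul_apply, hρ, (mem_words.1 hw).1, smul_smul, mul_smul_comm, mul_comm (M w)]
  rw [h1]
  generalize A * wordSum b F p.2 (antipode M) = Y
  rw [wordSum, LinearMap.sum_apply, wordSum, sum_mul]
  refine sum_congr rfl fun w _ => ?_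
  rw [LinearMap.smul_apply, hℓ, smul_mul_assoc]

/-- The Dynkin–Specht–Wever identity for alternal moulds. -/
theorem IsAlternal.sum_nestedComm {M : List α → ℂ} (hM : IsAlternal M) (b : α → 𝔸)
    (F : Finset α) (n : ℕ) :
    ∑ w ∈ words F n, M w • nestedComm b w = (n : ℂ) • wordSum b F n M := by
  -- The operators `ρ x` are minus right multiplications, twisted by adding the second component to
  -- the first, so that along a word applied to `(0, 1)` the first component counts the letters. The
  -- sum `ℓ x + ρ x` sends `(0, 1)` to `(-b x, 0)` and acts on pairs `(a, 0)` as the commutator with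
  -- `b x`.
  let ℓ : α → Module.End ℂ (𝔸 × 𝔸) := fun x =>
    (LinearMap.mulLeft ℂ (b x)).prodMap (LinearMap.mulLeft ℂ (b x))
  let ρ : α → Module.End ℂ (𝔸 × 𝔸) := fun x =>
    -((LinearMap.mulRight ℂ (b x) ∘ₗ (LinearMap.fst ℂ 𝔸 𝔸 + LinearMap.snd ℂ 𝔸 𝔸)).prod
      (LinearMap.mulRight ℂ (b x) ∘ₗ LinearMap.snd ℂ 𝔸 𝔸))
  have hℓx : ∀ x a a', ℓ x (a, a') = (b x * a, b x * a') := fun x a a' => rfl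
  have hρx : ∀ x a a', ρ x (a, a') = -((a + a') * b x, a' * b x) := fun x a a' => rfl
  have hc : ∀ x y, Commute (ℓ x) (ρ y) := fun x y => by
    refine LinearMap.ext fun ⟨a, a'⟩ => ?_
    rw [Module.End.mul_apply, Module.End.mul_apply, hρx, map_neg, hℓx, hℓx, hρx]
    simp only [mul_assoc, mul_add, add_mul]
  have hℓ : ∀ w : List α, (w.map ℓ).prod (0, 1) = (0, (w.map b).prod) := fun w => by
    induction w with
    | nil => simp
    | cons x w ih => simp [ih, hℓx]
  have hρ : ∀ w : List α, (w.map ρ).prod (0, 1) = ((-1 : ℂ) ^ w.length) •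
      ((w.length : ℂ) • (w.reverse.map b).prod, (w.reverse.map b).prod) := fun w => by
    induction w with
    | nil => simp
    | cons x w ih =>
      rw [List.map_cons, List.prod_cons, Module.End.mul_apply, ih, map_smul, hρx]
      simp only [List.reverse_cons, List.map_append, List.prod_append, List.length_cons, pow_succ,
        Nat.cast_succ, add_smul, one_smul, add_mul, smul_mul_assoc]
      simp
  have had : ∀ w : List α, w ≠ [] →
      (w.map fun x => ℓ x + ρ x).prod (0, 1) = (-nestedComm b w, 0) := fun w hw => by
    induction w with
    | nil => exact absurd rfl hw
    | cons x w ih =>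
      rw [List.map_cons, List.prod_cons, Module.End.mul_apply]
      rcases w with _ | ⟨y, w⟩
      · simp [hℓx, hρx, nestedComm]
      · rw [ih (by simp), LinearMap.add_apply, hℓx, hρx, nestedComm]
        simp [add_comm, sub_eq_add_neg]
  have h := LinearMap.congr_fun (hM.wordSum_add_letters ℓ ρ hc F n) (0, 1)
  have h1 : wordSum (fun x => ℓ x + ρ x) F n M (0, 1) =
      (-∑ w ∈ words F n, M w • nestedComm b w, 0) := by
    rw [wordSum, LinearMap.sum_apply, ← sum_neg_distrib]
    have : ∀ w ∈ words F n, (M w • (w.map fun x => ℓ x + ρ x).prod) (0, 1) =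
        (-(M w • nestedComm b w), (0 : 𝔸)) := fun w _ => by
      by_cases hw : w = []
      · subst hw
        simp [hM.1]
        rfl
      · rw [LinearMap.smul_apply, had w hw]
        simp
    rw [sum_congr rfl this]
    ext
    · simp [Prod.fst_sum]
    · simp [Prod.snd_sum]
  have h2 : wordSum ℓ F n M (0, 1) = (0, wordSum b F n M) := by
    rw [wordSum, LinearMap.sum_apply, wordSum]
    simp only [LinearMap.smul_apply, hℓ]
    ext
    · simp [Prod.fst_sum]
    · simp [Prod.snd_sum]
  have h3 : wordSum ρ F n M (0, 1) =
      ((n : ℂ) • wordSum b F n (antipode M), wordSum b F n (antipode M)) := by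
    rw [wordSum, LinearMap.sum_apply, wordSum_antipode, smul_sum]
    have : ∀ w ∈ words F n, (M w • (w.map ρ).prod) (0, 1) =
        ((n : ℂ) • ((-1) ^ n * M w) • (w.reverse.map b).prod,
          ((-1) ^ n * M w) • (w.reverse.map b).prod) := fun w hw => by
      rw [LinearMap.smul_apply, hρ, (mem_words.1 hw).1, smul_smul, Prod.smul_mk, mul_comm (M w),
        smul_comm]
    rw [sum_congr rfl this]
    ext
    · simp [Prod.fst_sum]
    · simp [Prod.snd_sum]
  rw [LinearMap.add_apply, h1, h2, h3, Prod.mk_add_mk, Prod.mk.injEq] at h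
  -- The second components say that the antipode changes the sign of the expansion; inserted in the
  -- first ones, this gives the claim.
  obtain ⟨h4, h5⟩ := h
  rw [zero_add, eq_neg_of_add_eq_zero_right h5.symm, smul_neg, neg_inj] at h4
  exact h4

end Adjoint

/-! ### Operator series: limits, graded sums, pointwise finiteness -/

section Series

variable {V : Type*} [AddCommGroup V] [Module ℂ V] {ι κ : Type*}

theorem coeff_mul_apply (X Y : PowerSeries (Module.End ℂ V)) (n : ℕ) (x : V) :
    PowerSeries.coeff n (X * Y) x =
      ∑ p ∈ antidiagonal n, PowerSeries.coeff p.1 X (PowerSeries.coeff p.2 Y x) := by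
  rw [PowerSeries.coeff_mul, LinearMap.sum_apply]
  rfl

/-- Convergence of series of operators: each coefficient is eventually constant at each vector. -/
def FormalLimit (l : Filter ι) (X : ι → PowerSeries (Module.End ℂ V))
    (Y : PowerSeries (Module.End ℂ V)) : Prop :=
  ∀ n x, ∀ᶠ i in l, PowerSeries.coeff n (X i) x = PowerSeries.coeff n Y x

namespace FormalLimit

variable {l : Filter ι} {X X' : ι → PowerSeries (Module.End ℂ V)}
  {Y Y' : PowerSeries (Module.End ℂ V)}

theorem const (Y : PowerSeries (Module.End ℂ V)) : FormalLimit l (fun _ => Y) Y :=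
  fun _ _ => .of_forall fun _ => rfl

theorem sub (h : FormalLimit l X Y) (h' : FormalLimit l X' Y') :
    FormalLimit l (fun i => X i - X' i) (Y - Y') := fun n x => by
  filter_upwards [h n x, h' n x] with i hi hi'
  rw [map_sub, map_sub, LinearMap.sub_apply, LinearMap.sub_apply, hi, hi']

theorem smul (c : ℂ) (h : FormalLimit l X Y) : FormalLimit l (fun i => c • X i) (c • Y) :=
  fun n x => by
    filter_upwards [h n x] with i hi
    rw [PowerSeries.coeff_smul, PowerSeries.coeff_smul, LinearMap.smul_apply,
      LinearMap.smul_apply, hi]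

/-- Once the right factor has stabilised at `x`, the left factor is evaluated at finitely many fixed
vectors. -/
theorem mul (h : FormalLimit l X Y) (h' : FormalLimit l X' Y') :
    FormalLimit l (fun i => X i * X' i) (Y * Y') := fun n x => by
  have h1 : ∀ p ∈ antidiagonal n, ∀ᶠ i in l,
      PowerSeries.coeff p.1 (X i) (PowerSeries.coeff p.2 (X' i) x) =
        PowerSeries.coeff p.1 Y (PowerSeries.coeff p.2 Y' x) := fun p _ => by
    filter_upwards [h p.1 (PowerSeries.coeff p.2 Y' x), h' p.2 x] with i hi hi'
    rw [hi', hi]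
  filter_upwards [(Filter.eventually_all_finset (antidiagonal n)).2 h1] with i hi
  rw [coeff_mul_apply, coeff_mul_apply]
  exact sum_congr rfl hi

theorem unique [l.NeBot] (h : FormalLimit l X Y) (h' : FormalLimit l X Y') : Y = Y' := by
  refine PowerSeries.ext fun n => LinearMap.ext fun x => ?_
  obtain ⟨i, hi, hi'⟩ := ((h n x).and (h' n x)).exists
  rw [← hi, hi']

theorem comp {l' : Filter κ} {f : κ → ι} (h : FormalLimit l X Y) (hf : Filter.Tendsto f l' l) :
    FormalLimit l' (fun k => X (f k)) Y := fun n x => hf.eventually (h n x)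

theorem of_basis {J : Type*} (v : Module.Basis J ℂ V)
    (h : ∀ n k, ∀ᶠ i in l, PowerSeries.coeff n (X i) (v k) = PowerSeries.coeff n Y (v k)) :
    FormalLimit l X Y := fun n x => by
  induction v.mem_span x using Submodule.span_induction with
  | mem x hx =>
    obtain ⟨k, rfl⟩ := hx
    exact h n k
  | zero => exact .of_forall fun i => by rw [map_zero, map_zero]
  | add x y _ _ hx hy =>
    filter_upwards [hx, hy] with i hi hi'
    rw [map_add, map_add, hi, hi']
  | smul c x _ hx =>
    filter_upwards [hx] with i hi
    rw [map_smul, map_smul, hi]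

end FormalLimit

/-- The coefficients of order less than `r` vanish. -/
def VanishesBelow (r : ℕ) (X : PowerSeries (Module.End ℂ V)) : Prop :=
  ∀ n < r, PowerSeries.coeff n X = 0

namespace VanishesBelow

variable {r s : ℕ} {X Y : PowerSeries (Module.End ℂ V)}

theorem mul (hX : VanishesBelow r X) (hY : VanishesBelow s Y) : VanishesBelow (r + s) (X * Y) :=
  fun n hn => by
    rw [PowerSeries.coeff_mul]
    refine sum_eq_zero fun p hp => ?_
    rw [HasAntidiagonal.mem_antidiagonal] at hp
    obtain h | h : p.1 < r ∨ p.2 < s := by omega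
    · rw [hX _ h, zero_mul]
    · rw [hY _ h, mul_zero]

theorem sub (hX : VanishesBelow r X) (hY : VanishesBelow r Y) : VanishesBelow r (X - Y) :=
  fun n hn => by rw [map_sub, hX n hn, hY n hn, sub_zero]

theorem smul (c : ℂ) (hX : VanishesBelow r X) : VanishesBelow r (c • X) :=
  fun n hn => by rw [PowerSeries.coeff_smul, hX n hn, smul_zero]

theorem sum {s : Finset ι} {F : ι → PowerSeries (Module.End ℂ V)}
    (h : ∀ i ∈ s, VanishesBelow r (F i)) : VanishesBelow r (∑ i ∈ s, F i) :=
  fun n hn => by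
    rw [map_sum]
    exact sum_eq_zero fun i hi => h i hi n hn

end VanishesBelow

/-- The sum of a sequence of series whose `r`-th term vanishes below order `r`. -/
noncomputable def total (f : ℕ → PowerSeries (Module.End ℂ V)) :
    PowerSeries (Module.End ℂ V) :=
  PowerSeries.mk fun n => ∑ r ∈ range (n + 1), PowerSeries.coeff n (f r)

theorem coeff_total (f : ℕ → PowerSeries (Module.End ℂ V)) (n : ℕ) :
    PowerSeries.coeff n (total f) = ∑ r ∈ range (n + 1), PowerSeries.coeff n (f r) :=
  PowerSeries.coeff_mk _ _

theorem coeff_total_of_le {f : ℕ → PowerSeries (Module.End ℂ V)}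
    (hf : ∀ r, VanishesBelow r (f r)) {n m : ℕ} (h : n ≤ m) :
    PowerSeries.coeff n (total f) = ∑ r ∈ range (m + 1), PowerSeries.coeff n (f r) := by
  rw [coeff_total]
  refine sum_subset (range_mono (by omega)) fun r _ hr => hf r n ?_
  rw [mem_range] at hr
  omega

theorem total_smul (c : ℂ) (f : ℕ → PowerSeries (Module.End ℂ V)) :
    total (fun r => c • f r) = c • total f := by
  ext1 n
  simp only [coeff_total, PowerSeries.coeff_smul, smul_sum]

theorem total_sub (f g : ℕ → PowerSeries (Module.End ℂ V)) :
    total (fun r => f r - g r) = total f - total g := by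
  ext1 n
  simp only [coeff_total, map_sub, sum_sub_distrib]

theorem total_single (s : ℕ) (X : PowerSeries (Module.End ℂ V)) (hX : VanishesBelow s X) :
    total (fun r => if r = s then X else 0) = X := by
  ext1 n
  rw [coeff_total]
  rcases lt_or_ge n s with h | h
  · rw [hX n h]
    refine sum_eq_zero fun r hr => ?_
    rw [mem_range] at hr
    rw [if_neg (by omega), map_zero]
  · rw [sum_eq_single s, if_pos rfl]
    · intro r _ hr
      rw [if_neg hr, map_zero]
    · intro hs
      rw [mem_range] at hs
      omega

/-- At order `n` both sides are sums over the square of pairs of degrees at most `n`; the pairs of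
total degree above `n` contribute zero. -/
theorem total_mul {f g : ℕ → PowerSeries (Module.End ℂ V)} (hf : ∀ r, VanishesBelow r (f r))
    (hg : ∀ r, VanishesBelow r (g r)) :
    total (fun n => ∑ p ∈ antidiagonal n, f p.1 * g p.2) = total f * total g := by
  ext1 n
  have h1 : PowerSeries.coeff n (total f * total g) =
      ∑ p ∈ range (n + 1) ×ˢ range (n + 1), PowerSeries.coeff n (f p.1 * g p.2) := by
    rw [sum_product, PowerSeries.coeff_mul]
    simp only [PowerSeries.coeff_mul]
    have : ∀ q ∈ antidiagonal n,
        PowerSeries.coeff q.1 (total f) * PowerSeries.coeff q.2 (total g) =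
          ∑ i ∈ range (n + 1), ∑ j ∈ range (n + 1),
            PowerSeries.coeff q.1 (f i) * PowerSeries.coeff q.2 (g j) := fun q hq => by
      rw [HasAntidiagonal.mem_antidiagonal] at hq
      rw [coeff_total_of_le hf (show q.1 ≤ n by omega),
        coeff_total_of_le hg (show q.2 ≤ n by omega), sum_mul_sum]
    rw [sum_congr rfl this, sum_comm]
    refine sum_congr rfl fun i _ => ?_
    rw [sum_comm]
  rw [h1, coeff_total]
  have h2 : ∀ r ∈ range (n + 1),
      PowerSeries.coeff n (∑ p ∈ antidiagonal r, f p.1 * g p.2) =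
        ∑ p ∈ range (n + 1) ×ˢ range (n + 1),
          if p.1 + p.2 = r then PowerSeries.coeff n (f p.1 * g p.2) else 0 := fun r hr => by
    rw [map_sum, ← sum_filter]
    refine sum_congr ?_ fun _ _ => rfl
    ext p
    simp only [HasAntidiagonal.mem_antidiagonal, mem_filter, mem_product, mem_range] at hr ⊢
    omega
  rw [sum_congr rfl h2, sum_comm]
  refine sum_congr rfl fun p _ => ?_
  rw [sum_ite_eq]
  split_ifs with h
  · rfl
  · rw [mem_range] at h
    exact ((hf p.1).mul (hg p.2) n (by omega)).symm

theorem total_const_mul (X : PowerSeries (Module.End ℂ V))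
    {f : ℕ → PowerSeries (Module.End ℂ V)} (hf : ∀ r, VanishesBelow r (f r)) :
    total (fun r => X * f r) = X * total f := by
  have hX : VanishesBelow 0 X := fun n hn => absurd hn (Nat.not_lt_zero n)
  rw [← total_single 0 X hX, ← total_mul _ hf]
  · congr 1
    funext n
    rw [sum_eq_single (0, n), if_pos rfl, total_single 0 X hX]
    · rintro ⟨i, j⟩ h hne
      rw [HasAntidiagonal.mem_antidiagonal] at h
      rw [if_neg, zero_mul]
      rintro rfl
      exact hne (by simpa using h)
    · simp
  · intro r n hn
    rw [if_neg (by omega), map_zero]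

theorem total_mul_const (X : PowerSeries (Module.End ℂ V))
    {f : ℕ → PowerSeries (Module.End ℂ V)} (hf : ∀ r, VanishesBelow r (f r)) :
    total (fun r => f r * X) = total f * X := by
  have hX : VanishesBelow 0 X := fun n hn => absurd hn (Nat.not_lt_zero n)
  rw [← total_single 0 X hX, ← total_mul hf]
  · congr 1
    funext n
    rw [sum_eq_single (n, 0), if_pos rfl, total_single 0 X hX]
    · rintro ⟨i, j⟩ h hne
      rw [HasAntidiagonal.mem_antidiagonal] at h
      rw [if_neg, mul_zero]
      rintro rfl
      exact hne (by simpa using h)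
    · simp
  · intro r n hn
    rw [if_neg (by omega), map_zero]

/-- At each order, only finitely many members of the family indexed by `s` act nontrivially on any
given vector. -/
def PointwiseFinite (s : Set ι) (F : ι → PowerSeries (Module.End ℂ V)) : Prop :=
  ∀ n x, {i ∈ s | PowerSeries.coeff n (F i) x ≠ 0}.Finite

theorem PointwiseFinite.of_basis {J : Type*} (v : Module.Basis J ℂ V) {s : Set ι}
    {F : ι → PowerSeries (Module.End ℂ V)}
    (h : ∀ n k, {i ∈ s | PowerSeries.coeff n (F i) (v k) ≠ 0}.Finite) : PointwiseFinite s F :=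
  fun n x => by
    induction v.mem_span x using Submodule.span_induction with
    | mem x hx =>
      obtain ⟨k, rfl⟩ := hx
      exact h n k
    | zero => simp
    | add x y _ _ hx hy =>
      refine (hx.union hy).subset fun i hi => ?_
      by_contra hcon
      simp only [Set.mem_union, Set.mem_ofPred_eq, not_or, not_and, not_not] at hcon
      exact hi.2 (by rw [map_add, hcon.1 hi.1, hcon.2 hi.1, add_zero])
    | smul c x _ hx =>
      refine hx.subset fun i hi => ⟨hi.1, fun h0 => hi.2 ?_⟩
      rw [map_smul, h0, smul_zero]

/-- Only finitely many right factors act on `x`, and they produce finitely many vectors, on each of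
which finitely many left factors act. -/
theorem PointwiseFinite.mul {s : Set ι} {t : Set κ} {F : ι → PowerSeries (Module.End ℂ V)}
    {G : κ → PowerSeries (Module.End ℂ V)} (hF : PointwiseFinite s F) (hG : PointwiseFinite t G) :
    PointwiseFinite (s ×ˢ t) fun p => F p.1 * G p.2 := fun n x => by
  have hfin : (⋃ q ∈ antidiagonal n, ⋃ j ∈ {j ∈ t | PowerSeries.coeff q.2 (G j) x ≠ 0},
      (fun i => (i, j)) ''
        {i ∈ s | PowerSeries.coeff q.1 (F i) (PowerSeries.coeff q.2 (G j) x) ≠ 0}).Finite :=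
    Set.Finite.biUnion (finite_toSet _) fun q _ => (hG q.2 x).biUnion fun j _ => (hF q.1 _).image _
  refine hfin.subset ?_
  rintro ⟨i, j⟩ ⟨⟨hi, hj⟩, hne⟩
  rw [coeff_mul_apply] at hne
  obtain ⟨q, hq, hq0⟩ := exists_ne_zero_of_sum_ne_zero hne
  refine Set.mem_biUnion hq (Set.mem_biUnion ⟨hj, fun h0 => ?_⟩ ⟨i, ⟨hi, hq0⟩, rfl⟩)
  rw [h0, map_zero] at hq0
  exact hq0 rfl

/-- Prepending a letter that acts by left or right multiplications preserves finiteness. -/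
theorem PointwiseFinite.cons {α : Type*} {b : α → PowerSeries (Module.End ℂ V)}
    (hb : PointwiseFinite Set.univ b) {Y : List α → PowerSeries (Module.End ℂ V)} {r : ℕ}
    (hY : PointwiseFinite {w | w.length = r} Y)
    (hstep : ∀ z w, w.length = r → ∀ n x, PowerSeries.coeff n (Y (z :: w)) x ≠ 0 →
      PowerSeries.coeff n (b z * Y w) x ≠ 0 ∨ PowerSeries.coeff n (Y w * b z) x ≠ 0) :
    PointwiseFinite {w | w.length = r + 1} Y := fun n x => by
  refine (((hb.mul hY n x).image fun p => p.1 :: p.2).union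
    ((hY.mul hb n x).image fun p => p.2 :: p.1)).subset ?_
  rintro w ⟨hw, hne⟩
  rcases w with _ | ⟨z, w⟩
  · simp at hw
  have hw' : w.length = r := by simpa using hw
  rcases hstep z w hw' n x hne with h | h
  · exact Or.inl ⟨(z, w), ⟨⟨trivial, hw'⟩, h⟩, rfl⟩
  · exact Or.inr ⟨(w, z), ⟨⟨hw', trivial⟩, h⟩, rfl⟩

/-- A family indexed by words is summable as soon as it is so in each length. -/
theorem PointwiseFinite.of_length {α : Type*} {Y : List α → PowerSeries (Module.End ℂ V)}
    (hY : ∀ r, PointwiseFinite {w | w.length = r} Y) (hv : ∀ w, VanishesBelow w.length (Y w)) :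
    PointwiseFinite Set.univ Y := fun n x => by
  refine (Set.Finite.biUnion (finite_toSet (range (n + 1))) fun r _ => hY r n x).subset ?_
  rintro w ⟨-, hne⟩
  refine Set.mem_biUnion (x := w.length) ?_ ⟨rfl, hne⟩
  simp only [coe_range, Set.mem_Iio]
  by_contra hlt
  exact hne (by rw [hv w n (by omega), LinearMap.zero_apply])

end Series

/-! ### Formal sums as limits of finite sums -/

section FormalSum

variable {H : Type*} [NormedAddCommGroup H] [InnerProductSpace ℂ H] {J : Set ℕ}
  {e : HilbertBasis J ℂ H} {ι α : Type*}

theorem FormallySummable.pointwiseFinite {F : ι → PowerSeries (Op e)}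
    (h : FormallySummable e F) : PointwiseFinite Set.univ F :=
  .of_basis (coreBasis e) fun n k => by simpa using h n k

theorem PointwiseFinite.formallySummable {F : ι → PowerSeries (Op e)}
    (h : PointwiseFinite Set.univ F) : FormallySummable e F := fun n k => by
  simpa using h n (coreBasis e k)

theorem coeff_formalSum_basis (F : ι → PowerSeries (Op e)) (n : ℕ) (k : J) :
    PowerSeries.coeff n (formalSum e F) (coreBasis e k) =
      ∑ᶠ i, PowerSeries.coeff n (F i) (coreBasis e k) := by
  rw [formalSum, PowerSeries.coeff_mk, Module.Basis.constr_basis]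

/-- The finite partial sums converge to the formal sum. -/
theorem FormallySummable.formalLimit {F : ι → PowerSeries (Op e)} (h : FormallySummable e F) :
    FormalLimit Filter.atTop (fun s : Finset ι => ∑ i ∈ s, F i) (formalSum e F) := by
  refine .of_basis (coreBasis e) fun n k => ?_
  filter_upwards [Filter.eventually_ge_atTop (h n k).toFinset] with s hs
  rw [coeff_formalSum_basis, map_sum, LinearMap.sum_apply, finsum_eq_sum_of_support_subset]
  intro i hi
  exact hs ((h n k).mem_toFinset.2 hi)

/-- The sums over words on finite sets of letters converge to the formal sum over all words. -/
theorem FormallySummable.formalLimit_words {Y : List α → PowerSeries (Op e)}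
    (h : FormallySummable e Y) (hv : ∀ w, VanishesBelow w.length (Y w)) :
    FormalLimit Filter.atTop
      (fun F : Finset α => total fun r => ∑ w ∈ words F r, Y w) (formalSum e Y) := by
  classical
  refine .of_basis (coreBasis e) fun n k => ?_
  -- It suffices that `F` contain the letters of the finitely many words acting on `e_k` at order
  -- `n`.
  filter_upwards [Filter.eventually_ge_atTop
    ((h n k).toFinset.biUnion fun w => w.toFinset)] with F hF
  rw [coeff_formalSum_basis, coeff_total, LinearMap.sum_apply,
    finsum_eq_sum_of_support_subset (s := (range (n + 1)).biUnion (words F)), sum_biUnion]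
  · refine sum_congr rfl fun r _ => ?_
    rw [map_sum, LinearMap.sum_apply]
  · intro r _ s _ hrs
    rw [Function.onFun, disjoint_left]
    intro w hr hs
    exact hrs ((mem_words.1 hr).1.symm.trans (mem_words.1 hs).1)
  · intro w hw
    rw [Function.mem_support] at hw
    simp only [coe_biUnion, Set.mem_iUnion, mem_coe]
    refine ⟨w.length, ?_, mem_words.2 ⟨rfl, fun x hx => hF ?_⟩⟩
    · rw [mem_range]
      by_contra hlt
      exact hw (by rw [hv w n (by omega), LinearMap.zero_apply])
    · exact mem_biUnion.2 ⟨w, (h n k).mem_toFinset.2 hw, List.mem_toFinset.2 hx⟩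

end FormalSum

/-! ### Calculus of formal adjoints -/

section AdjointSeries

variable {H : Type*} [NormedAddCommGroup H] [InnerProductSpace ℂ H] {J : Set ℕ}
  {e : HilbertBasis J ℂ H} {ι : Type*}

namespace IsAdjointSeries

variable {X X' Y Y' : PowerSeries (Op e)}

theorem symm (h : IsAdjointSeries e X X') : IsAdjointSeries e X' X := fun n x y => by
  rw [← inner_conj_symm, ← h n y x, inner_conj_symm]

theorem one : IsAdjointSeries e (1 : PowerSeries (Op e)) 1 := fun n x y => by
  rw [PowerSeries.coeff_one]
  split_ifs <;> simp

theorem add (h : IsAdjointSeries e X X') (h' : IsAdjointSeries e Y Y') :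
    IsAdjointSeries e (X + Y) (X' + Y') := fun n x y => by
  rw [map_add, map_add, LinearMap.add_apply, LinearMap.add_apply, inner_add_left, inner_add_right,
    h n, h' n]

theorem smul (c : ℂ) (h : IsAdjointSeries e X X') :
    IsAdjointSeries e (c • X) (starRingEnd ℂ c • X') := fun n x y => by
  rw [PowerSeries.coeff_smul, PowerSeries.coeff_smul, LinearMap.smul_apply, LinearMap.smul_apply,
    inner_smul_left, inner_smul_right, h n]

theorem neg (h : IsAdjointSeries e X X') : IsAdjointSeries e (-X) (-X') := fun n x y => by
  rw [map_neg, map_neg, LinearMap.neg_apply, LinearMap.neg_apply, inner_neg_left, inner_neg_right,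
    h n]

theorem sum {s : Finset ι} {F F' : ι → PowerSeries (Op e)}
    (h : ∀ i ∈ s, IsAdjointSeries e (F i) (F' i)) :
    IsAdjointSeries e (∑ i ∈ s, F i) (∑ i ∈ s, F' i) := fun n x y => by
  rw [map_sum, map_sum, LinearMap.sum_apply, LinearMap.sum_apply, sum_inner, inner_sum]
  exact sum_congr rfl fun i hi => h i hi n x y

theorem mul (h : IsAdjointSeries e X X') (h' : IsAdjointSeries e Y Y') :
    IsAdjointSeries e (X * Y) (Y' * X') := fun n x y => by
  rw [coeff_mul_apply, coeff_mul_apply, sum_inner, inner_sum,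
    ← Nat.sum_antidiagonal_swap]
  refine sum_congr rfl fun p _ => ?_
  rw [h, h']
  rfl

theorem total {f f' : ℕ → PowerSeries (Op e)} (h : ∀ r, IsAdjointSeries e (f r) (f' r)) :
    IsAdjointSeries e (total f) (total f') := fun n x y => by
  rw [coeff_total, coeff_total, LinearMap.sum_apply, LinearMap.sum_apply, sum_inner, inner_sum]
  exact sum_congr rfl fun r _ => h r n x y

theorem of_formalLimit {l : Filter ι} [l.NeBot] {F F' : ι → PowerSeries (Op e)}
    (h : ∀ i, IsAdjointSeries e (F i) (F' i)) (hX : FormalLimit l F X)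
    (hX' : FormalLimit l F' X') : IsAdjointSeries e X X' := fun n x y => by
  obtain ⟨i, h1, h2⟩ := ((hX n x).and (hX' n y)).exists
  rw [← h1, ← h2, h i]

theorem of_basis
    (h : ∀ n k l, inner ℂ (PowerSeries.coeff n X (coreBasis e k)) (coreBasis e l) =
      inner ℂ (coreBasis e k) (PowerSeries.coeff n X' (coreBasis e l))) :
    IsAdjointSeries e X X' := fun n x y => by
  induction (coreBasis e).mem_span x using Submodule.span_induction with
  | mem x hx =>
    obtain ⟨k, rfl⟩ := hx
    induction (coreBasis e).mem_span y using Submodule.span_induction with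
    | mem y hy =>
      obtain ⟨l, rfl⟩ := hy
      exact h n k l
    | zero => simp
    | add y z _ _ hy hz => rw [inner_add_right, hy, hz, map_add, inner_add_right]
    | smul c y _ hy => rw [inner_smul_right, hy, map_smul, inner_smul_right]
  | zero => simp
  | add x z _ _ hx hz => rw [map_add, inner_add_left, hx, hz, inner_add_left]
  | smul c x _ hx => rw [map_smul, inner_smul_left, hx, inner_smul_left]

end IsAdjointSeries

end AdjointSeries

/-! ### Frequency components of `B` and the action of `H₀` -/

section Components

variable {H : Type*} [NormedAddCommGroup H] [InnerProductSpace ℂ H] {J : Set ℕ}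
  {e : HilbertBasis J ℂ H}

theorem orthonormal_coreBasis (e : HilbertBasis J ℂ H) : Orthonormal ℂ (coreBasis e) := by
  rw [orthonormal_iff_ite]
  intro i j
  rw [Submodule.coe_inner, coreBasis_coe, coreBasis_coe]
  exact orthonormal_iff_ite.1 e.orthonormal i j

theorem inner_coreBasis (k : J) (x : core e) :
    inner ℂ (coreBasis e k) x = (coreBasis e).repr x k := by
  conv_lhs => rw [← (coreBasis e).linearCombination_repr x]
  exact (orthonormal_coreBasis e).inner_right_finsupp _ _

theorem inner_coreBasis_right (k : J) (x : core e) :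
    inner ℂ x (coreBasis e k) = starRingEnd ℂ ((coreBasis e).repr x k) := by
  rw [← inner_coreBasis, inner_conj_symm]

theorem ext_repr {A A' : Op e}
    (h : ∀ k l, (coreBasis e).repr (A (coreBasis e l)) k =
      (coreBasis e).repr (A' (coreBasis e l)) k) : A = A' :=
  (coreBasis e).ext fun l => (coreBasis e).repr.injective (Finsupp.ext fun k => h k l)

open Classical in
theorem repr_opComponent (ħ : ℝ) (E₀ : J → ℝ) (z : ℂ) (A : Op e) (k l : J) :
    (coreBasis e).repr (opComponent e ħ E₀ z A (coreBasis e l)) k =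
      if (E₀ k : ℂ) - (E₀ l : ℂ) = Complex.I * (ħ : ℂ) * z then
        (coreBasis e).repr (A (coreBasis e l)) k else 0 := by
  rw [opComponent, Module.Basis.constr_basis, LinearEquiv.apply_symm_apply, Finsupp.filter_apply]

theorem coeff_component (ħ : ℝ) (E₀ : J → ℝ) (B : PowerSeries (Op e)) (z : ℂ) (n : ℕ) :
    PowerSeries.coeff n (component e ħ E₀ B z) = opComponent e ħ E₀ z (PowerSeries.coeff n B) := by
  rw [component, PowerSeries.coeff_mk]

/-- The frequency of a pair of indices. -/
noncomputable def freq (ħ : ℝ) (E₀ : J → ℝ) (k l : J) : freqs ħ E₀ :=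
  ⟨((E₀ k : ℂ) - (E₀ l : ℂ)) / (Complex.I * (ħ : ℂ)), k, l, rfl⟩

theorem I_mul_ne_zero {ħ : ℝ} (hħ : 0 < ħ) : Complex.I * (ħ : ℂ) ≠ 0 :=
  mul_ne_zero Complex.I_ne_zero (Complex.ofReal_ne_zero.2 hħ.ne')

theorem eq_freq_iff {ħ : ℝ} (hħ : 0 < ħ) (E₀ : J → ℝ) (z : freqs ħ E₀) (k l : J) :
    (E₀ k : ℂ) - (E₀ l : ℂ) = Complex.I * (ħ : ℂ) * (z : ℂ) ↔ z = freq ħ E₀ k l := by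
  rw [Subtype.ext_iff, freq, eq_div_iff (I_mul_ne_zero hħ), eq_comm, mul_comm (z : ℂ)]

open Classical in
theorem repr_component {ħ : ℝ} (hħ : 0 < ħ) (E₀ : J → ℝ) (B : PowerSeries (Op e))
    (z : freqs ħ E₀) (n : ℕ) (k l : J) :
    (coreBasis e).repr (PowerSeries.coeff n (component e ħ E₀ B z) (coreBasis e l)) k =
      if z = freq ħ E₀ k l then
        (coreBasis e).repr (PowerSeries.coeff n B (coreBasis e l)) k else 0 := by
  simp only [coeff_component, repr_opComponent, eq_freq_iff hħ]

/-- At a given order, the image of `e_l` under `B` has finite support, and each `k` in it determines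
a single frequency. -/
theorem formallySummable_component {ħ : ℝ} (hħ : 0 < ħ) (E₀ : J → ℝ) (B : PowerSeries (Op e)) :
    FormallySummable e fun z : freqs ħ E₀ => component e ħ E₀ B z := fun n l => by
  classical
  refine (((coreBasis e).repr (PowerSeries.coeff n B (coreBasis e l))).support.finite_toSet.image
    fun k => freq ħ E₀ k l).subset fun z hz => ?_
  have hz' : (coreBasis e).repr
      (PowerSeries.coeff n (component e ħ E₀ B z) (coreBasis e l)) ≠ 0 := fun h =>
    hz ((coreBasis e).repr.map_eq_zero_iff.1 h)
  obtain ⟨k, hk⟩ := Finsupp.ne_iff.1 hz'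
  rw [repr_component hħ, Finsupp.coe_zero, Pi.zero_apply] at hk
  split_ifs at hk with h
  · exact ⟨k, Finsupp.mem_support_iff.2 hk, h.symm⟩
  · exact absurd rfl hk

theorem formalSum_component {ħ : ℝ} (hħ : 0 < ħ) (E₀ : J → ℝ) (B : PowerSeries (Op e)) :
    formalSum e (fun z : freqs ħ E₀ => component e ħ E₀ B z) = B := by
  classical
  refine PowerSeries.ext fun n => ext_repr fun k l => ?_
  rw [coeff_formalSum_basis]
  have h := ((coreBasis e).coord k).toAddMonoidHom.map_finsum
    (formallySummable_component (e := e) hħ E₀ B n l)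
  simp only [LinearMap.toAddMonoidHom_coe, Module.Basis.coord_apply, repr_component hħ] at h
  rw [h, finsum_eq_single _ (freq ħ E₀ k l) fun z hz => if_neg hz, if_pos rfl]

theorem vanishesBelow_component (ħ : ℝ) (E₀ : J → ℝ) {B : PowerSeries (Op e)}
    (hB : PowerSeries.coeff 0 B = 0) (z : ℂ) : VanishesBelow 1 (component e ħ E₀ B z) :=
  fun n hn => by
    classical
    obtain rfl : n = 0 := by omega
    refine ext_repr fun k l => ?_
    rw [coeff_component, repr_opComponent, hB]
    simp

/-- Complex conjugation on the alphabet of frequencies. -/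
noncomputable def freqConj {ħ : ℝ} {E₀ : J → ℝ} (z : freqs ħ E₀) : freqs ħ E₀ :=
  ⟨starRingEnd ℂ z, by
    obtain ⟨k, l, h⟩ := z.2
    refine ⟨l, k, ?_⟩
    rw [h]
    simp only [map_div₀, map_sub, map_mul, Complex.conj_ofReal, Complex.conj_I]
    rw [neg_mul, div_neg, ← neg_div, neg_sub]⟩

theorem freqConj_freqConj {ħ : ℝ} {E₀ : J → ℝ} (z : freqs ħ E₀) : freqConj (freqConj z) = z :=
  Subtype.ext (Complex.conj_conj _)

theorem freqConj_freq {ħ : ℝ} {E₀ : J → ℝ} (k l : J) :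
    freqConj (freq ħ E₀ k l) = freq ħ E₀ l k := by
  refine Subtype.ext ?_
  simp only [freqConj, freq, map_div₀, map_sub, map_mul, Complex.conj_ofReal, Complex.conj_I]
  rw [neg_mul, div_neg, ← neg_div, neg_sub]

/-- Exchanging `k` and `l` conjugates the frequency, since it is a real number divided by `iħ`. -/
theorem isAdjointSeries_component {ħ : ℝ} (hħ : 0 < ħ) (E₀ : J → ℝ) {B : PowerSeries (Op e)}
    (hB : IsSymmetricSeries e B) (z : freqs ħ E₀) :
    IsAdjointSeries e (component e ħ E₀ B z) (component e ħ E₀ B (freqConj z)) := by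
  classical
  refine .of_basis fun n k l => ?_
  have h := hB n (coreBasis e k) (coreBasis e l)
  rw [inner_coreBasis, inner_coreBasis_right] at h
  have hz : freqConj z = freq ħ E₀ k l ↔ z = freq ħ E₀ l k := by
    rw [← freqConj_freq l k]
    refine ⟨fun h => ?_, fun h => congrArg freqConj h⟩
    have h' := congrArg freqConj h
    rwa [freqConj_freqConj, freqConj_freqConj] at h'
  rw [inner_coreBasis, inner_coreBasis_right, repr_component hħ, repr_component hħ]
  simp only [hz]
  split_ifs
  · exact h
  · exact map_zero _

section Diagonal

variable [CompleteSpace H] {H₀ : H →ₗ.[ℂ] H} {E₀ : J → ℝ}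

theorem IsDiagonalIn.restrict_coreBasis (h : IsDiagonalIn H₀ e E₀)
    (k : J) :
    h.restrict (coreBasis e k) = (E₀ k : ℂ) • coreBasis e k := by
  refine Subtype.ext ?_
  rw [Submodule.coe_smul, coreBasis_coe, ← h.eigen k]
  exact congrArg H₀.toFun (Subtype.ext (coreBasis_coe e k))

theorem IsDiagonalIn.repr_restrict (h : IsDiagonalIn H₀ e E₀)
    (x : core e) (k : J) :
    (coreBasis e).repr (h.restrict x) k = E₀ k * (coreBasis e).repr x k := by
  have : (coreBasis e).coord k ∘ₗ h.restrict = (E₀ k : ℂ) • (coreBasis e).coord k := by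
    refine (coreBasis e).ext fun l => ?_
    rw [LinearMap.comp_apply, h.restrict_coreBasis, map_smul, LinearMap.smul_apply,
      Module.Basis.coord_apply, Module.Basis.repr_self]
    by_cases hkl : l = k
    · rw [hkl]
    · simp [hkl]
  exact LinearMap.congr_fun this x

theorem IsDiagonalIn.isAdjointSeries_restrict (h : IsDiagonalIn H₀ e E₀)
    :
    IsAdjointSeries e (PowerSeries.C h.restrict) (PowerSeries.C h.restrict) := by
  refine .of_basis fun n k l => ?_
  rw [PowerSeries.coeff_C]
  split_ifs
  · rw [h.restrict_coreBasis, h.restrict_coreBasis, inner_smul_left, inner_smul_right,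
      Complex.conj_ofReal, orthonormal_iff_ite.1 (orthonormal_coreBasis e)]
    split_ifs with hkl
    · rw [hkl]
    · simp
  · simp

theorem IsDiagonalIn.qbr_component (h : IsDiagonalIn H₀ e E₀)
    {ħ : ℝ} (hħ : 0 < ħ) (B : PowerSeries (Op e))
    (z : freqs ħ E₀) :
    qbr e ħ (PowerSeries.C h.restrict) (component e ħ E₀ B z) =
      (z : ℂ) • component e ħ E₀ B z := by
  classical
  refine PowerSeries.ext fun n => ext_repr fun k l => ?_
  rw [qbr, PowerSeries.coeff_smul, PowerSeries.coeff_smul, map_sub, PowerSeries.coeff_C_mul,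
    PowerSeries.coeff_mul_C]
  simp only [LinearMap.smul_apply, LinearMap.sub_apply, Module.End.mul_apply, map_smul, map_sub,
    h.restrict_coreBasis, Finsupp.smul_apply, Finsupp.sub_apply, h.repr_restrict, smul_eq_mul,
    repr_component hħ]
  split_ifs with hz
  · rw [hz, freq]
    field_simp
  · simp

end Diagonal

end Components

/-! ### The three expansions in the letters `B_λ / iħ` -/

section Expansions

variable {H : Type*} [NormedAddCommGroup H] [InnerProductSpace ℂ H] {J : Set ℕ}
  (e : HilbertBasis J ℂ H) (ħ : ℝ) (E₀ : J → ℝ) (B : PowerSeries (Op e))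

/-- The component of `B` divided by `iħ`. -/
noncomputable def scaledComponent (z : freqs ħ E₀) : PowerSeries (Op e) :=
  (1 / (Complex.I * (ħ : ℂ))) • component e ħ E₀ B z

variable {e ħ E₀ B}

theorem qbr_eq (X Y : PowerSeries (Op e)) :
    qbr e ħ X Y = ((1 / (Complex.I * (ħ : ℂ))) • X) * Y -
      Y * ((1 / (Complex.I * (ħ : ℂ))) • X) := by
  rw [qbr, smul_sub, smul_mul_assoc, mul_smul_comm]

theorem components_cons (z : freqs ħ E₀) (w : List (freqs ħ E₀)) :
    components e ħ E₀ B (z :: w) = component e ħ E₀ B z :: components e ħ E₀ B w := rfl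

theorem prod_map_scaledComponent (w : List (freqs ħ E₀)) :
    (w.map (scaledComponent e ħ E₀ B)).prod =
      (1 / (Complex.I * (ħ : ℂ))) ^ w.length • (components e ħ E₀ B w).prod := by
  induction w with
  | nil => simp [components]
  | cons z w ih =>
    rw [List.map_cons, List.prod_cons, ih, components_cons, List.prod_cons, scaledComponent,
      smul_mul_smul_comm, List.length_cons, pow_succ']

theorem termC_eq (w : List (freqs ħ E₀)) :
    termC e ħ E₀ B w = mouldS (fun z : freqs ħ E₀ => (z : ℂ)) w •
      (w.map (scaledComponent e ħ E₀ B)).prod := by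
  rw [termC, prod_map_scaledComponent, smul_smul, mul_comm]

theorem termPsi_eq (A : PowerSeries (Op e)) (w : List (freqs ħ E₀)) :
    termPsi e ħ E₀ B A w = mouldS (fun z : freqs ħ E₀ => (z : ℂ)) w •
      iterComm (scaledComponent e ħ E₀ B) w A := by
  rw [termPsi]
  congr 1
  induction w with
  | nil => rfl
  | cons z w ih =>
    rw [iterComm, List.foldr_cons, ← iterComm, ← ih]
    exact qbr_eq _ _

/-- A nested bracket of `r` components carries `r - 1` factors `1 / iħ`, and a commutator of scaled
components carries `r`; hence the extra factor. -/
theorem smul_nestedBr (w : List (freqs ħ E₀)) :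
    (1 / (Complex.I * (ħ : ℂ))) • nestedBr e ħ (components e ħ E₀ B w) =
      nestedComm (scaledComponent e ħ E₀ B) w := by
  induction w with
  | nil => simp [components, nestedBr, nestedComm]
  | cons z w ih =>
    rcases w with _ | ⟨y, w⟩
    · rfl
    · rw [nestedComm, ← ih, mul_smul_comm, smul_mul_assoc, ← smul_sub]
      congr 1
      exact qbr_eq _ _

theorem smul_termN (w : List (freqs ħ E₀)) :
    (1 / (Complex.I * (ħ : ℂ))) • termN e ħ E₀ B w =
      mouldN (fun z : freqs ħ E₀ => (z : ℂ)) w • nestedComm (scaledComponent e ħ E₀ B) w := by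
  rw [termN, smul_comm, smul_nestedBr]

theorem pointwiseFinite_scaledComponent (hħ : 0 < ħ) :
    PointwiseFinite Set.univ (scaledComponent e ħ E₀ B) := fun n x => by
  refine ((formallySummable_component hħ E₀ B).pointwiseFinite n x).subset fun z hz =>
    ⟨trivial, fun h => hz.2 ?_⟩
  rw [scaledComponent, PowerSeries.coeff_smul, LinearMap.smul_apply, h, smul_zero]

theorem vanishesBelow_scaledComponent (hB : PowerSeries.coeff 0 B = 0) (z : freqs ħ E₀) :
    VanishesBelow 1 (scaledComponent e ħ E₀ B z) :=
  (vanishesBelow_component ħ E₀ hB z).smul _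

end Expansions

/-! ### Summability over words and commutators with expansions -/

section WordFamilies

variable {V α : Type*} [AddCommGroup V] [Module ℂ V] {b : α → PowerSeries (Module.End ℂ V)}

theorem vanishesBelow_zero (X : PowerSeries (Module.End ℂ V)) : VanishesBelow 0 X :=
  fun _ hn => absurd hn (Nat.not_lt_zero _)

theorem vanishesBelow_prod (hb : ∀ x, VanishesBelow 1 (b x)) (w : List α) :
    VanishesBelow w.length (w.map b).prod := by
  induction w with
  | nil => exact vanishesBelow_zero _
  | cons x w ih =>
    rw [List.map_cons, List.prod_cons, List.length_cons, add_comm]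
    exact (hb x).mul ih

theorem vanishesBelow_iterComm (hb : ∀ x, VanishesBelow 1 (b x))
    (A : PowerSeries (Module.End ℂ V)) (w : List α) :
    VanishesBelow w.length (iterComm b w A) := by
  induction w with
  | nil => exact vanishesBelow_zero _
  | cons x w ih =>
    refine VanishesBelow.sub ?_ (ih.mul (hb x))
    rw [List.length_cons, add_comm]
    exact (hb x).mul ih

theorem vanishesBelow_nestedComm (hb : ∀ x, VanishesBelow 1 (b x)) (w : List α) :
    VanishesBelow w.length (nestedComm b w) := by
  induction w with
  | nil => exact vanishesBelow_zero _
  | cons x w ih =>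
    rcases w with _ | ⟨y, w⟩
    · exact hb x
    · refine VanishesBelow.sub ?_ (ih.mul (hb x))
      rw [List.length_cons, add_comm]
      exact (hb x).mul ih

theorem vanishesBelow_wordSum (hb : ∀ x, VanishesBelow 1 (b x)) (F : Finset α) (r : ℕ)
    (M : List α → ℂ) : VanishesBelow r (wordSum b F r M) :=
  .sum fun w hw => .smul _ ((mem_words.1 hw).1 ▸ vanishesBelow_prod hb w)

theorem total_wordSum_sub (F : Finset α) (M N : List α → ℂ) :
    total (fun r => wordSum b F r (M - N)) =
      total (fun r => wordSum b F r M) - total (fun r => wordSum b F r N) := by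
  simp only [wordSum_sub, total_sub]

theorem total_wordSum_convol (hb : ∀ x, VanishesBelow 1 (b x)) (F : Finset α)
    (M N : List α → ℂ) :
    total (fun r => wordSum b F r (convol M N)) =
      total (fun r => wordSum b F r M) * total (fun r => wordSum b F r N) := by
  rw [← total_mul (fun r => vanishesBelow_wordSum hb F r M)
    fun r => vanishesBelow_wordSum hb F r N]
  simp only [wordSum_convol]

theorem pointwiseFinite_length_zero (Y : List α → PowerSeries (Module.End ℂ V)) :
    PointwiseFinite {w : List α | w.length = 0} Y := fun _ _ =>
  (Set.finite_singleton []).subset fun _ hw => List.length_eq_zero_iff.1 hw.1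

theorem coeff_sub_ne_zero {X Y : PowerSeries (Module.End ℂ V)} {n : ℕ} {x : V}
    (h : PowerSeries.coeff n (X - Y) x ≠ 0) :
    PowerSeries.coeff n X x ≠ 0 ∨ PowerSeries.coeff n Y x ≠ 0 := by
  by_contra! hcon
  rw [map_sub, LinearMap.sub_apply, hcon.1, hcon.2, sub_zero] at h
  exact h rfl

theorem pointwiseFinite_prod (hb : PointwiseFinite Set.univ b) (hv : ∀ x, VanishesBelow 1 (b x)) :
    PointwiseFinite Set.univ fun w : List α => (w.map b).prod := by
  refine .of_length (fun r => ?_) (vanishesBelow_prod hv)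
  induction r with
  | zero => exact pointwiseFinite_length_zero _
  | succ r ih => exact hb.cons ih fun _ _ _ _ _ h => Or.inl h

theorem pointwiseFinite_iterComm (hb : PointwiseFinite Set.univ b)
    (hv : ∀ x, VanishesBelow 1 (b x)) (A : PowerSeries (Module.End ℂ V)) :
    PointwiseFinite Set.univ fun w : List α => iterComm b w A := by
  refine .of_length (fun r => ?_) (vanishesBelow_iterComm hv A)
  induction r with
  | zero => exact pointwiseFinite_length_zero _
  | succ r ih => exact hb.cons ih fun _ _ _ _ _ h => coeff_sub_ne_zero h

theorem pointwiseFinite_nestedComm (hb : PointwiseFinite Set.univ b)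
    (hv : ∀ x, VanishesBelow 1 (b x)) : PointwiseFinite Set.univ (nestedComm b) := by
  refine .of_length (fun r => ?_) (vanishesBelow_nestedComm hv)
  induction r with
  | zero => exact pointwiseFinite_length_zero _
  | succ r ih =>
    -- Single letters are treated apart: the recursion of `nestedComm` starts at length one, not at
    -- the empty word.
    rcases r with _ | r
    · intro n x
      refine ((hb n x).image fun z => [z]).subset ?_
      rintro w ⟨hw, hne⟩
      obtain ⟨z, rfl⟩ := List.length_eq_one_iff.1 (show w.length = 1 from hw)
      exact ⟨z, ⟨trivial, hne⟩, rfl⟩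
    · refine hb.cons ih fun z w hw n x h => ?_
      rcases w with _ | ⟨y, w⟩
      · simp at hw
      · exact coeff_sub_ne_zero h

theorem PointwiseFinite.smul {ι : Type*} {s : Set ι} {F : ι → PowerSeries (Module.End ℂ V)}
    (hF : PointwiseFinite s F) (c : ι → ℂ) : PointwiseFinite s fun i => c i • F i := fun n x => by
  refine (hF n x).subset fun i hi => ⟨hi.1, fun h => hi.2 ?_⟩
  rw [PowerSeries.coeff_smul, LinearMap.smul_apply, h, smul_zero]

/-- Derivations given by commutators act on expansions through the weights of the letters. -/
theorem comm_wordSum {𝔸 : Type*} [Ring 𝔸] [Algebra ℂ 𝔸] {b : α → 𝔸} {X : 𝔸} {φ : α → ℂ}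
    (hb : ∀ x, X * b x - b x * X = φ x • b x) (F : Finset α) (r : ℕ) (M : List α → ℂ) :
    X * wordSum b F r M - wordSum b F r M * X = wordSum b F r (nabla φ M) := by
  have hw : ∀ w : List α, X * (w.map b).prod - (w.map b).prod * X =
      (w.map φ).sum • (w.map b).prod := fun w => by
    induction w with
    | nil => simp
    | cons x w ih =>
      rw [List.map_cons, List.prod_cons, List.map_cons, List.sum_cons, add_smul,
        ← smul_mul_assoc, ← mul_smul_comm, ← hb, ← ih]
      noncomm_ring
  rw [wordSum, wordSum, mul_sum, sum_mul, ← sum_sub_distrib]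
  refine sum_congr rfl fun w _ => ?_
  rw [mul_smul_comm, smul_mul_assoc, ← smul_sub, hw, nabla, smul_smul, mul_comm]

end WordFamilies

/-! ### Conjugation, unitarity and normalization -/

section Main

variable {H : Type*} [NormedAddCommGroup H] [InnerProductSpace ℂ H] {J : Set ℕ}
  {e : HilbertBasis J ℂ H} {ħ : ℝ} {E₀ : J → ℝ} {B : PowerSeries (Op e)}

theorem formallySummable_termC (hħ : 0 < ħ) (hB0 : PowerSeries.coeff 0 B = 0) :
    FormallySummable e (termC e ħ E₀ B) := by
  rw [funext (termC_eq (e := e) (ħ := ħ) (E₀ := E₀) (B := B))]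
  exact ((pointwiseFinite_prod (pointwiseFinite_scaledComponent hħ)
    (vanishesBelow_scaledComponent hB0)).smul _).formallySummable

theorem formallySummable_termPsi (hħ : 0 < ħ) (hB0 : PowerSeries.coeff 0 B = 0)
    (A : PowerSeries (Op e)) : FormallySummable e (termPsi e ħ E₀ B A) := by
  rw [funext (termPsi_eq (e := e) (ħ := ħ) (E₀ := E₀) (B := B) A)]
  exact ((pointwiseFinite_iterComm (pointwiseFinite_scaledComponent hħ)
    (vanishesBelow_scaledComponent hB0) A).smul _).formallySummable

theorem termN_eq (hħ : 0 < ħ) (w : List (freqs ħ E₀)) :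
    termN e ħ E₀ B w = (Complex.I * (ħ : ℂ) * mouldN (fun z : freqs ħ E₀ => (z : ℂ)) w) •
      nestedComm (scaledComponent e ħ E₀ B) w := by
  rw [mul_smul, ← smul_termN, smul_smul, mul_one_div_cancel (I_mul_ne_zero hħ), one_smul]

theorem formallySummable_termN (hħ : 0 < ħ) (hB0 : PowerSeries.coeff 0 B = 0) :
    FormallySummable e (termN e ħ E₀ B) := by
  rw [funext (termN_eq (e := e) (E₀ := E₀) (B := B) hħ)]
  exact ((pointwiseFinite_nestedComm (pointwiseFinite_scaledComponent hħ)
    (vanishesBelow_scaledComponent hB0)).smul _).formallySummable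

/-- The expansion of the inverse of `C`, obtained by applying the antipode to `S`. -/
noncomputable def conjInv (e : HilbertBasis J ℂ H) (ħ : ℝ) (E₀ : J → ℝ)
    (B : PowerSeries (Op e)) : PowerSeries (Op e) :=
  formalSum e fun w : List (freqs ħ E₀) =>
    antipode (mouldS fun z : freqs ħ E₀ => (z : ℂ)) w • (w.map (scaledComponent e ħ E₀ B)).prod

theorem formalLimit_conjC (hħ : 0 < ħ) (hB0 : PowerSeries.coeff 0 B = 0) :
    FormalLimit Filter.atTop (fun F : Finset (freqs ħ E₀) => total fun r =>
      wordSum (scaledComponent e ħ E₀ B) F r (mouldS fun z : freqs ħ E₀ => (z : ℂ)))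
      (conjC e ħ E₀ B) := by
  have h := (formallySummable_termC (E₀ := E₀) hħ hB0).formalLimit_words fun w => by
    rw [termC_eq]
    exact (vanishesBelow_prod (vanishesBelow_scaledComponent hB0) w).smul _
  simp only [termC_eq] at h
  exact h

theorem formalLimit_conjInv (hħ : 0 < ħ) (hB0 : PowerSeries.coeff 0 B = 0) :
    FormalLimit Filter.atTop (fun F : Finset (freqs ħ E₀) => total fun r =>
      wordSum (scaledComponent e ħ E₀ B) F r (antipode (mouldS fun z : freqs ħ E₀ => (z : ℂ))))
      (conjInv e ħ E₀ B) :=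
  ((pointwiseFinite_prod (pointwiseFinite_scaledComponent hħ)
    (vanishesBelow_scaledComponent hB0)).smul _).formallySummable.formalLimit_words fun w =>
      (vanishesBelow_prod (vanishesBelow_scaledComponent hB0) w).smul _

theorem formalLimit_Psi (hħ : 0 < ħ) (hB0 : PowerSeries.coeff 0 B = 0)
    (A : PowerSeries (Op e)) :
    FormalLimit Filter.atTop (fun F : Finset (freqs ħ E₀) => total fun r =>
      ∑ w ∈ words F r, mouldS (fun z : freqs ħ E₀ => (z : ℂ)) w •
        iterComm (scaledComponent e ħ E₀ B) w A) (Psi e ħ E₀ B A) := by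
  have h := (formallySummable_termPsi (E₀ := E₀) hħ hB0 A).formalLimit_words fun w => by
    rw [termPsi_eq]
    exact (vanishesBelow_iterComm (vanishesBelow_scaledComponent hB0) A w).smul _
  simp only [termPsi_eq] at h
  exact h

/-- The Dynkin identity replaces nested brackets weighted by `N` with plain products weighted by
`rN`, the form in which `N` enters the mould equation. -/
theorem formalLimit_normalForm (hħ : 0 < ħ) (hB0 : PowerSeries.coeff 0 B = 0) :
    FormalLimit Filter.atTop (fun F : Finset (freqs ħ E₀) => total fun r =>
      wordSum (scaledComponent e ħ E₀ B) F r (lengthN fun z : freqs ħ E₀ => (z : ℂ)))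
      ((1 / (Complex.I * (ħ : ℂ))) • normalForm e ħ E₀ B) := by
  have h := (formallySummable_termN (E₀ := E₀) hħ hB0).formalLimit_words fun w => by
    rw [termN_eq hħ]
    exact (vanishesBelow_nestedComm (vanishesBelow_scaledComponent hB0) w).smul _
  have h' := h.smul (1 / (Complex.I * (ħ : ℂ)))
  simp only [← total_smul, smul_sum, smul_termN, (isAlternal_mouldN _).sum_nestedComm] at h'
  rw [normalForm]
  convert h' using 3 with F
  funext r
  rw [wordSum, wordSum, smul_sum]
  refine sum_congr rfl fun w hw => ?_
  rw [lengthN, (mem_words.1 hw).1, smul_smul]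

theorem formalLimit_letters (hħ : 0 < ħ) (hB0 : PowerSeries.coeff 0 B = 0) :
    FormalLimit Filter.atTop (fun F : Finset (freqs ħ E₀) => total fun r =>
      wordSum (scaledComponent e ħ E₀ B) F r mouldI) ((1 / (Complex.I * (ħ : ℂ))) • B) := by
  have h := (formallySummable_component (E₀ := E₀) hħ B).formalLimit.smul
    (1 / (Complex.I * (ħ : ℂ)))
  rw [formalSum_component hħ] at h
  convert h using 2 with F
  simp only [wordSum_mouldI]
  rw [total_single 1 _ (.sum fun x _ => vanishesBelow_scaledComponent hB0 x), smul_sum]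
  rfl

/-- `Ψ` is the conjugation by `C`. -/
theorem Psi_eq (hħ : 0 < ħ) (hB0 : PowerSeries.coeff 0 B = 0) (A : PowerSeries (Op e)) :
    Psi e ħ E₀ B A = conjC e ħ E₀ B * (A * conjInv e ħ E₀ B) := by
  refine (formalLimit_Psi hħ hB0 A).unique ?_
  have hb := vanishesBelow_scaledComponent (e := e) (ħ := ħ) (E₀ := E₀) hB0
  have h := (formalLimit_conjC (E₀ := E₀) hħ hB0).mul
    ((FormalLimit.const A).mul (formalLimit_conjInv (E₀ := E₀) hħ hB0))
  convert h using 2 with F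
  rw [← total_const_mul A fun r => vanishesBelow_wordSum hb F r _,
    ← total_mul (fun r => vanishesBelow_wordSum hb F r _) fun r => by
      simpa using (vanishesBelow_zero A).mul (vanishesBelow_wordSum hb F r _)]
  simp only [(isSymmetral_mouldS _).sum_iterComm]

/-- Commutators with the identity vanish, so only the empty word remains. With `Psi_eq` this gives
the right inverse of `C` without a separate antipode identity. -/
theorem Psi_one (hħ : 0 < ħ) (hB0 : PowerSeries.coeff 0 B = 0) : Psi e ħ E₀ B 1 = 1 := by
  refine (formalLimit_Psi hħ hB0 1).unique ?_
  convert FormalLimit.const (1 : PowerSeries (Op e)) using 2 with F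
  conv_rhs => rw [← total_single 0 1 (vanishesBelow_zero (1 : PowerSeries (Op e)))]
  congr 1
  funext r
  have hone : ∀ w : List (freqs ħ E₀), w ≠ [] →
      iterComm (scaledComponent e ħ E₀ B) w (1 : PowerSeries (Op e)) = 0 := fun w hw => by
    induction w with
    | nil => exact absurd rfl hw
    | cons z w ih =>
      rw [iterComm, List.foldr_cons, ← iterComm]
      rcases w with _ | ⟨y, w⟩
      · simp [iterComm]
      · rw [ih (by simp), mul_zero, zero_mul, sub_zero]
  split_ifs with hr
  · subst hr
    simp [words, mouldS_nil, iterComm]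
  · refine sum_eq_zero fun w hw => ?_
    rw [hone w, smul_zero]
    rintro rfl
    exact hr (mem_words.1 hw).1.symm

theorem conjC_mul_conjInv (hħ : 0 < ħ) (hB0 : PowerSeries.coeff 0 B = 0) :
    conjC e ħ E₀ B * conjInv e ħ E₀ B = 1 := by
  rw [← Psi_one (E₀ := E₀) hħ hB0, Psi_eq hħ hB0, one_mul]

theorem coeff_zero_conjC (hħ : 0 < ħ) (hB0 : PowerSeries.coeff 0 B = 0) :
    PowerSeries.coeff 0 (conjC e ħ E₀ B) = 1 := by
  refine LinearMap.ext fun x => ?_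
  obtain ⟨F, hF⟩ := (formalLimit_conjC (E₀ := E₀) hħ hB0 0 x).exists
  rw [← hF, coeff_total, sum_range_one, wordSum_zero, mouldS_nil, one_smul,
    PowerSeries.coeff_zero_one]

/-- A series with constant term `1` has a left inverse, which must agree with the right inverse
already found. -/
theorem conjInv_mul_conjC (hħ : 0 < ħ) (hB0 : PowerSeries.coeff 0 B = 0) :
    conjInv e ħ E₀ B * conjC e ħ E₀ B = 1 := by
  have h := PowerSeries.invOfUnit_mul (conjC e ħ E₀ B) 1 (by
    rw [← PowerSeries.coeff_zero_eq_constantCoeff_apply, coeff_zero_conjC hħ hB0, Units.val_one])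
  rwa [left_inv_eq_right_inv h (conjC_mul_conjInv hħ hB0)] at h

/-- The formal adjoint of `C` is its inverse. -/
theorem isAdjointSeries_conjC (hħ : 0 < ħ) (hBs : IsSymmetricSeries e B)
    (hB0 : PowerSeries.coeff 0 B = 0) :
    IsAdjointSeries e (conjC e ħ E₀ B) (conjInv e ħ E₀ B) := by
  classical
  -- Adjoints conjugate the letters, so the partial sum of `C` on `F` is adjoint to that of
  -- `conjInv` on the conjugate set, which also exhausts the alphabet.
  have himg : Filter.Tendsto (fun F : Finset (freqs ħ E₀) => F.image freqConj)
      Filter.atTop Filter.atTop := by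
    refine Filter.tendsto_atTop.2 fun F₀ => ?_
    filter_upwards [Filter.eventually_ge_atTop (F₀.image freqConj)] with F hF z hz
    exact mem_image.2 ⟨freqConj z, hF (mem_image_of_mem _ hz), freqConj_freqConj z⟩
  refine .of_formalLimit (fun F => ?_) (formalLimit_conjC hħ hB0)
    ((formalLimit_conjInv hħ hB0).comp himg)
  refine .total fun r => ?_
  -- The sign comes from conjugating `1 / iħ`. Along a word these signs, together with the reversal
  -- of products, make up the antipode.
  have hletter : ∀ z : freqs ħ E₀, IsAdjointSeries e (scaledComponent e ħ E₀ B z)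
      ((-1 : ℂ) • scaledComponent e ħ E₀ B (freqConj z)) := fun z => by
    have h := (isAdjointSeries_component hħ E₀ hBs z).smul (1 / (Complex.I * (ħ : ℂ)))
    have hc : starRingEnd ℂ (1 / (Complex.I * (ħ : ℂ))) = -(1 / (Complex.I * (ħ : ℂ))) := by
      simp only [map_div₀, map_mul, map_one, Complex.conj_ofReal, Complex.conj_I]
      rw [neg_mul, div_neg]
    rwa [hc, neg_eq_neg_one_mul, mul_smul] at h
  have hprod : ∀ w : List (freqs ħ E₀),
      IsAdjointSeries e (w.map (scaledComponent e ħ E₀ B)).prod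
        ((-1 : ℂ) ^ w.length •
          ((w.map freqConj).reverse.map (scaledComponent e ħ E₀ B)).prod) := fun w => by
    induction w with
    | nil => simpa using IsAdjointSeries.one
    | cons z w ih =>
      have h := (hletter z).mul ih
      simp only [List.map_cons, List.prod_cons, List.reverse_cons, List.map_append,
        List.prod_append, List.length_cons, pow_succ, List.map_nil, List.prod_nil, mul_one]
      rwa [smul_mul_smul_comm] at h
  rw [wordSum_antipode, ← sum_words_map F r freqConj freqConj_freqConj]
  refine .sum fun w hw => ?_
  have h := (hprod w).smul (mouldS (fun z : freqs ħ E₀ => (z : ℂ)) w)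
  rwa [← mouldS_map_conj _ (fun z : freqs ħ E₀ => (z : ℂ)) freqConj freqConj_freqConj
    (fun _ => rfl), smul_smul, mul_comm, (mem_words.1 hw).1] at h

section Diagonal

variable [CompleteSpace H] {H₀ : H →ₗ.[ℂ] H}

theorem IsDiagonalIn.comm_scaledComponent (hH₀ : IsDiagonalIn H₀ e E₀) (hħ : 0 < ħ)
    (z : freqs ħ E₀) :
    ((1 / (Complex.I * (ħ : ℂ))) • PowerSeries.C hH₀.restrict) * scaledComponent e ħ E₀ B z -
      scaledComponent e ħ E₀ B z * ((1 / (Complex.I * (ħ : ℂ))) • PowerSeries.C hH₀.restrict) =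
      (z : ℂ) • scaledComponent e ħ E₀ B z := by
  have h := congrArg (fun X => (1 / (Complex.I * (ħ : ℂ))) • X) (hH₀.qbr_component hħ B z)
  simp only [qbr_eq] at h
  rw [scaledComponent, smul_comm (z : ℂ), ← h, smul_sub, mul_smul_comm,
    smul_mul_assoc _ (component e ħ E₀ B z)]

theorem IsDiagonalIn.comm_total (hH₀ : IsDiagonalIn H₀ e E₀) (hħ : 0 < ħ)
    (hB0 : PowerSeries.coeff 0 B = 0) (F : Finset (freqs ħ E₀))
    (M : List (freqs ħ E₀) → ℂ) :
    ((1 / (Complex.I * (ħ : ℂ))) • PowerSeries.C hH₀.restrict) *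
        (total fun r => wordSum (scaledComponent e ħ E₀ B) F r M) -
      (total fun r => wordSum (scaledComponent e ħ E₀ B) F r M) *
        ((1 / (Complex.I * (ħ : ℂ))) • PowerSeries.C hH₀.restrict) =
      total fun r => wordSum (scaledComponent e ħ E₀ B) F r
        (nabla (fun z : freqs ħ E₀ => (z : ℂ)) M) := by
  have hb := vanishesBelow_scaledComponent (e := e) (ħ := ħ) (E₀ := E₀) hB0
  rw [← total_const_mul _ fun r => vanishesBelow_wordSum hb F r _,
    ← total_mul_const _ fun r => vanishesBelow_wordSum hb F r _, ← total_sub]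
  simp only [comm_wordSum (hH₀.comm_scaledComponent hħ)]

theorem IsDiagonalIn.comm_normalForm (hH₀ : IsDiagonalIn H₀ e E₀) (hħ : 0 < ħ)
    (hB0 : PowerSeries.coeff 0 B = 0) :
    PowerSeries.C hH₀.restrict * normalForm e ħ E₀ B -
      normalForm e ħ E₀ B * PowerSeries.C hH₀.restrict = 0 := by
  set c : ℂ := 1 / (Complex.I * (ħ : ℂ)) with hc
  have hc0 : c ≠ 0 := one_div_ne_zero (I_mul_ne_zero hħ)
  have hN := formalLimit_normalForm (E₀ := E₀) hħ hB0
  have h := ((FormalLimit.const (c • PowerSeries.C hH₀.restrict)).mul hN).sub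
    (hN.mul (FormalLimit.const (c • PowerSeries.C hH₀.restrict)))
  simp only [hc, hH₀.comm_total hħ hB0, nabla_lengthN] at h
  have h0 : ∀ F : Finset (freqs ħ E₀),
      (total fun r => wordSum (scaledComponent e ħ E₀ B) F r 0) = 0 := fun F => by
    ext1 n
    simp [coeff_total, wordSum]
  simp only [h0, ← hc] at h
  have h1 := h.unique (FormalLimit.const 0)
  rw [smul_mul_smul_comm, smul_mul_smul_comm, ← smul_sub] at h1
  exact (smul_eq_zero.1 h1).resolve_left (mul_ne_zero hc0 hc0)

/-- This is `nabla_mouldS` read on operators: `∇`, `I` and `rN` become the commutator with `H₀ /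
iħ`, `B / iħ` and `N / iħ`, and the common factor `1 / iħ` is cancelled. -/
theorem IsDiagonalIn.comm_conjC (hH₀ : IsDiagonalIn H₀ e E₀) (hħ : 0 < ħ)
    (hB0 : PowerSeries.coeff 0 B = 0) :
    PowerSeries.C hH₀.restrict * conjC e ħ E₀ B - conjC e ħ E₀ B * PowerSeries.C hH₀.restrict =
      conjC e ħ E₀ B * B - normalForm e ħ E₀ B * conjC e ħ E₀ B := by
  have hc0 : 1 / (Complex.I * (ħ : ℂ)) ≠ 0 := one_div_ne_zero (I_mul_ne_zero hħ)
  have hb := vanishesBelow_scaledComponent (e := e) (ħ := ħ) (E₀ := E₀) hB0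
  have hC := formalLimit_conjC (E₀ := E₀) hħ hB0
  have hN := formalLimit_normalForm (E₀ := E₀) hħ hB0
  have h := ((FormalLimit.const ((1 / (Complex.I * (ħ : ℂ))) • PowerSeries.C hH₀.restrict)).mul
    hC).sub (hC.mul
      (FormalLimit.const ((1 / (Complex.I * (ħ : ℂ))) • PowerSeries.C hH₀.restrict)))
  have h' := (hC.mul (formalLimit_letters (E₀ := E₀) hħ hB0)).sub (hN.mul hC)
  simp only [hH₀.comm_total hħ hB0, nabla_mouldS, total_wordSum_sub,
    total_wordSum_convol hb] at h
  have h1 := h.unique h'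
  rw [smul_mul_assoc, mul_smul_comm, mul_smul_comm, smul_mul_assoc, ← smul_sub, ← smul_sub] at h1
  exact smul_right_injective _ hc0 h1

theorem IsDiagonalIn.Psi_add (hH₀ : IsDiagonalIn H₀ e E₀) (hħ : 0 < ħ)
    (hB0 : PowerSeries.coeff 0 B = 0) :
    Psi e ħ E₀ B (PowerSeries.C hH₀.restrict + B) =
      PowerSeries.C hH₀.restrict + normalForm e ħ E₀ B := by
  have h : conjC e ħ E₀ B * (PowerSeries.C hH₀.restrict + B) =
      (PowerSeries.C hH₀.restrict + normalForm e ħ E₀ B) * conjC e ħ E₀ B := by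
    have h1 := hH₀.comm_conjC hħ hB0
    rw [sub_eq_sub_iff_add_eq_add] at h1
    rw [mul_add, add_mul, h1, add_comm]
  rw [Psi_eq hħ hB0, ← mul_assoc, h, mul_assoc, conjC_mul_conjInv hħ hB0, mul_one]

/-- Conjugation by the unitary `C` preserves the symmetry of `H₀ + B`, and `N` is the result minus
`H₀`. -/
theorem IsDiagonalIn.isSymmetricSeries_normalForm (hH₀ : IsDiagonalIn H₀ e E₀) (hħ : 0 < ħ)
    (hBs : IsSymmetricSeries e B) (hB0 : PowerSeries.coeff 0 B = 0) :
    IsSymmetricSeries e (normalForm e ħ E₀ B) := by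
  have hC := isAdjointSeries_conjC (E₀ := E₀) hħ hBs hB0
  have h := (hC.mul ((hH₀.isAdjointSeries_restrict.add hBs).mul hC.symm)).add
    hH₀.isAdjointSeries_restrict.neg
  rw [mul_assoc, ← Psi_eq hħ hB0, hH₀.Psi_add hħ hB0, add_neg_cancel_comm] at h
  exact h

end Diagonal

end Main

end BirkhoffRS

open BirkhoffRS in
theorem theorem3p1 {H : Type*} [NormedAddCommGroup H] [InnerProductSpace ℂ H] [CompleteSpace H]
    {J : Set ℕ} (e : HilbertBasis J ℂ H) (ħ : ℝ) (hħ : 0 < ħ)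
    (H₀ : H →ₗ.[ℂ] H) (E₀ : J → ℝ) (hH₀ : IsDiagonalIn H₀ e E₀)
    (B : PowerSeries (Op e)) (hBsymm : IsSymmetricSeries e B) (hBband : IsFiniteBand e B)
    (hB0 : PowerSeries.coeff 0 B = 0) :
    -- the recursively defined moulds are the unique Birkhoff decomposition of `T`
    (∀ Um Up : List (freqs ħ E₀) → LaurentSeries ℂ,
      IsBirkhoffDecomposition (mouldT fun z : freqs ħ E₀ => (z : ℂ)) Um Up ↔
        Um = birkhoffMinus (mouldT fun z : freqs ħ E₀ => (z : ℂ)) ∧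
          Up = birkhoffPlus (mouldT fun z : freqs ħ E₀ => (z : ℂ))) ∧
    -- `B` is the sum of its components, which are eigenvectors of `(1/iħ)[H₀, ·]`
    FormallySummable e (fun z : freqs ħ E₀ => component e ħ E₀ B z) ∧
    formalSum e (fun z : freqs ħ E₀ => component e ħ E₀ B z) = B ∧
    (∀ z : freqs ħ E₀,
      qbr e ħ (PowerSeries.C hH₀.restrict) (component e ħ E₀ B z) =
        (z : ℂ) • component e ħ E₀ B z) ∧
    -- the three expansions make sense
    FormallySummable e (termN e ħ E₀ B) ∧
    FormallySummable e (termC e ħ E₀ B) ∧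
    (∀ A : PowerSeries (Op e), FormallySummable e (termPsi e ħ E₀ B A)) ∧
    -- `N` is symmetric
    IsSymmetricSeries e (normalForm e ħ E₀ B) ∧
    -- `C` is unitary, with inverse `C'`, and `Ψ` is conjugation by `C`
    (∃ C' : PowerSeries (Op e),
      IsAdjointSeries e (conjC e ħ E₀ B) C' ∧
      conjC e ħ E₀ B * C' = 1 ∧ C' * conjC e ħ E₀ B = 1 ∧
      ∀ A : PowerSeries (Op e), Psi e ħ E₀ B A = conjC e ħ E₀ B * A * C') ∧
    -- normalization
    Psi e ħ E₀ B (PowerSeries.C hH₀.restrict + B) =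
      PowerSeries.C hH₀.restrict + normalForm e ħ E₀ B ∧
    PowerSeries.C hH₀.restrict * normalForm e ħ E₀ B -
      normalForm e ħ E₀ B * PowerSeries.C hH₀.restrict = 0 := by
  have hT := mouldT_nil (fun z : freqs ħ E₀ => (z : ℂ))
  refine ⟨fun Um Up => ⟨fun h => h.unique hT, ?_⟩, formallySummable_component hħ E₀ B,
    formalSum_component hħ E₀ B, hH₀.qbr_component hħ B, formallySummable_termN hħ hB0,
    formallySummable_termC hħ hB0, formallySummable_termPsi hħ hB0,
    hH₀.isSymmetricSeries_normalForm hħ hBsymm hB0,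
    ⟨conjInv e ħ E₀ B, isAdjointSeries_conjC hħ hBsymm hB0, conjC_mul_conjInv hħ hB0,
      conjInv_mul_conjC hħ hB0, fun A => by rw [Psi_eq hħ hB0, mul_assoc]⟩,
    hH₀.Psi_add hħ hB0, hH₀.comm_normalForm hħ hB0⟩
  rintro ⟨rfl, rfl⟩
  exact isBirkhoffDecomposition hT
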